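/- Let $K$ be a field and let $\mathbf Q$ denote the poset (viewed as a category) of non-negative rational numbers. Consider functors $F\colon\mathbf Q\to\mathrm{Vect}_K$. *Tame and compact functors.* $F$ is *tame* if for some rational $\alpha>0$ it is isomorphic to $v\mapsto F'(\lfloor v/\alpha\rfloor)$ for some functor $F'\colon\mathbf N\to\mathrm{Vect}_K$. $F$ is *compact* if, whenever $F$ is the colimit in $\mathrm{Fun}(\mathbf Q,\mathrm{Vect}_K)$ of an increasing sequence of subfunctors $A_0\subset A_1\subset\cdots\subset F$, one has $A_k=F$ for some $k$. *Free functors, bars, rank.* Let $K(v,-)$ be the $K$-linear span of the representable functor $\mathrm{mor}_{\mathbf Q}(v,-)$. For $w\le u$ let $[w,u)$ be the cokernel of the inclusion $K(u,-)\subset K(w,-)$. A *minimal cover* of $G$ by $P=\bigoplus_{k=1}^nK(v_k,-)$ is an epimorphism $\phi\colon P\to G$ such that every $f\colon P\to P$ with $\phi f=\phi$ is an isomorphism; then $\mathrm{rank}(G)=n$. If $G$ has no such cover (for any finite $n$), put $\mathrm{rank}(G)=\infty$. *Noise systems.* A *noise system* is a family $\{\mathcal S_\epsilon\}_{\epsilon\in\mathbf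 Q}$ of collections of tame functors such that $0\in\mathcal S_\epsilon$ for all $\epsilon$; $\mathcal S_\tau\subseteq\mathcal S_\epsilon$ for $\tau<\epsilon$; and for every short exact sequence $0\to F\to G\to H\to0$ of tame functors, $G\in\mathcal S_\epsilon$ implies $F,H\in\mathcal S_\epsilon$, while $F\in\mathcal S_\epsilon$ and $H\in\mathcal S_\tau$ imply $G\in\mathcal S_{\epsilon+\tau}$. Its components are *closed under direct sums* if $F,G\in\mathcal S_\epsilon$ implies $F\oplus G\in\mathcal S_\epsilon$, for every $\epsilon$. *Feature counting invariant.* A natural transformation $\phi$ is an *$\epsilon$-equivalence* if $\ker\phi\in\mathcal S_\tau$ and $\mathrm{coker}\,\phi\in\mathcal S_\mu$ for some $\tau+\mu\le\epsilon$. Tame functors $F,G$ are *$\epsilon$-close* if there are a tame functor $H$, a $\tau$-equivalence $H\to F$ and a $\mu$-equivalence $H\to G$ with $\tau+\mu\le\epsilon$. Let $d(F,G)$ be the infimum of all $\epsilon\in\mathbf Q$ for which $F$ and $G$ are $\epsilon$-close ($\infty$ if there are none). For rational $t>0$ put $$\mathrm{bar}(F)_t=\min\{\mathrm{rank}(G)\mid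 G\text{ tame},\ d(F,G)<t\}.$$ **Proposition.** Let $\{\mathcal S_\epsilon\}_{\epsilon\in\mathbf Q}$ be a noise system whose components are closed under direct sums, and let $F\colon\mathbf Q\to\mathrm{Vect}_K$ be compact and tame. Then $F$ is isomorphic to a finite direct sum $\bigoplus_{i\in I}[w_i,u_i)\oplus\bigoplus_{j\in J}K(v_j,-)$ with $w_i\le u_i$, and for every such decomposition and every rational $t>0$, $$\mathrm{bar}(F)_t=\big|\{i\in I\mid [w_i,u_i)\notin\mathcal S_\epsilon\text{ for all }\epsilon<t\}\big|+\big|\{j\in J\mid K(v_j,-)\notin\mathcal S_\epsilon\text{ for all }\epsilon<t\}\big|,$$ where $\epsilon$ ranges over the non-negative rationals. -/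

import Mathlib

open CategoryTheory CategoryTheory.Limits
open scoped NNReal ENNReal

universe u

namespace FeatureCounting

/-- Functors from the poset of non-negative rational numbers to `K`-vector spaces. -/
abbrev PersFun (K : Type u) [Field K] : Type (u + 1) := ℚ≥0 ⥤ ModuleCat.{u} K

instance (K : Type u) [Field K] : HasFiniteBiproducts (PersFun K) :=
  Abelian.hasFiniteBiproducts

/-! ### Free functors and bars -/

section Free

variable (K : Type u) [Field K]

/-- The free functor on one generator `K(v,-)`: the composite of the representable functor
`mor(v,-)` with the linear span functor. -/
noncomputable def freeOne (v : ℚ≥0) : PersFun K :=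
  coyoneda.obj (Opposite.op v) ⋙ uliftFunctor.{u, 0} ⋙ ModuleCat.free K

/-- For `w ≤ u`, the inclusion `K(u,-) ⟶ K(w,-)` induced by the morphism `w ⟶ u`. -/
noncomputable def freeOneIncl {w u : ℚ≥0} (h : w ≤ u) : freeOne K u ⟶ freeOne K w :=
  Functor.whiskerRight (coyoneda.map (homOfLE h).op) (uliftFunctor.{u, 0} ⋙ ModuleCat.free K)

/-- The bar `[w,u)` for `w ≤ u`: the cokernel of the inclusion `K(u,-) ⟶ K(w,-)`.
For `w = u` this is the zero functor. -/
noncomputable def bar {w u : ℚ≥0} (h : w ≤ u) : PersFun K :=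
  cokernel (freeOneIncl K h)

end Free

/-! ### Tame functors -/

/-- `b_α v`, the largest natural number `n` with `α n ≤ v` (for `α > 0`). -/
def gridFloor (α v : ℚ≥0) : ℕ := ⌊v / α⌋₊

theorem isGreatest_gridFloor {α : ℚ≥0} (hα : 0 < α) (v : ℚ≥0) :
    IsGreatest {n : ℕ | α * (n : ℚ≥0) ≤ v} (gridFloor α v) := by
  constructor
  · have h : ((⌊v / α⌋₊ : ℕ) : ℚ≥0) ≤ v / α := Nat.floor_le zero_le
    rw [le_div_iff₀ hα, mul_comm] at h
    exact h
  · intro n hn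
    refine Nat.le_floor ?_
    rw [le_div_iff₀ hα, mul_comm]
    exact hn

theorem gridFloor_mono (α : ℚ≥0) : Monotone (gridFloor α) := fun _ _ h =>
  Nat.floor_mono (div_le_div_of_nonneg_right h zero_le)

/-- The extension `α^! F` of `F : ℕ ⥤ C`, with `α^! F (v) = F (b_α v)`. -/
def gridExtend {C : Type*} [Category C] (α : ℚ≥0) (F : ℕ ⥤ C) : ℚ≥0 ⥤ C :=
  (gridFloor_mono α).functor ⋙ F

/-- A functor is tame if it is isomorphic to `α^! F` for some positive rational `α` and some
functor `F` on the natural numbers. -/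
def IsTame {C : Type*} [Category C] (G : ℚ≥0 ⥤ C) : Prop :=
  ∃ α : ℚ≥0, 0 < α ∧ ∃ F : ℕ ⥤ C, Nonempty (G ≅ gridExtend α F)

/-! ### Compact objects -/

/-- `A` is compact if, whenever `A` is the colimit of an increasing sequence
`A₀ ⊂ A₁ ⊂ ⋯ ⊂ A` of subobjects of `A`, one has `A_k = A` for some `k`. -/
def IsCompactObj {C : Type*} [Category C] (A : C) : Prop :=
  ∀ (X : ℕ ⥤ C) (ι : X ⟶ (Functor.const ℕ).obj A), (∀ i, Mono (ι.app i)) →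
    Nonempty (IsColimit (Cocone.mk A ι)) → ∃ k, IsIso (ι.app k)

/-! ### Minimal covers and rank -/

/-- A morphism `φ : X ⟶ Y` is minimal if every endomorphism `f` of `X` with `φ f = φ` is an
isomorphism. -/
def IsMinimalHom {C : Type*} [Category C] {X Y : C} (φ : X ⟶ Y) : Prop :=
  ∀ f : X ⟶ X, f ≫ φ = φ → IsIso f

/-- `G` has a minimal cover by a free functor `K(v₁,-) ⊕ ⋯ ⊕ K(vₙ,-)` of rank `n`
(equivalently, a minimal set of `n` generators). -/
def HasRank {K : Type u} [Field K] (G : PersFun K) (n : ℕ) : Prop :=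
  ∃ (v : Fin n → ℚ≥0) (φ : (⨁ fun k => freeOne K (v k)) ⟶ G), Epi φ ∧ IsMinimalHom φ

/-- The rank of `G`: the rank of the free functor in a minimal cover of `G` if `G` is of finite
rank, and `⊤` otherwise. (Minimal covers are unique up to isomorphism, so the infimum is over at
most one number.) -/
noncomputable def rank {K : Type u} [Field K] (G : PersFun K) : ℕ∞ :=
  ⨅ (n : ℕ) (_ : HasRank G n), (n : ℕ∞)

/-! ### Noise systems -/

/-- A noise system in the category of tame functors. The component `S ε` is the collection of
noise of size at most `ε`. -/
structure NoiseSystem (K : Type u) [Field K] where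
  /-- the components -/
  S : ℚ≥0 → ObjectProperty (PersFun K)
  tame : ∀ (ε : ℚ≥0) (F : PersFun K), S ε F → IsTame F
  zero_mem : ∀ (ε : ℚ≥0) (F : PersFun K), IsZero F → S ε F
  mono : ∀ (τ ε : ℚ≥0), τ < ε → ∀ F : PersFun K, S τ F → S ε F
  sub_mem : ∀ (ε : ℚ≥0) (E : ShortComplex (PersFun K)), E.ShortExact →
    IsTame E.X₁ → IsTame E.X₂ → IsTame E.X₃ → S ε E.X₂ → S ε E.X₁
  quot_mem : ∀ (ε : ℚ≥0) (E : ShortComplex (PersFun K)), E.ShortExact →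
    IsTame E.X₁ → IsTame E.X₂ → IsTame E.X₃ → S ε E.X₂ → S ε E.X₃
  ext_mem : ∀ (ε τ : ℚ≥0) (E : ShortComplex (PersFun K)), E.ShortExact →
    IsTame E.X₁ → IsTame E.X₂ → IsTame E.X₃ → S ε E.X₁ → S τ E.X₃ → S (ε + τ) E.X₂

namespace NoiseSystem

variable {K : Type u} [Field K] (N : NoiseSystem K)

/-- Every component of the noise system is closed under direct sums. -/
def ClosedUnderDirectSums : Prop :=
  ∀ (ε : ℚ≥0) (F G : PersFun K), N.S ε F → N.S ε G → N.S ε (F ⊞ G)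

/-- `φ` is an `ε`-equivalence. -/
def IsEquivalence {F G : PersFun K} (φ : F ⟶ G) (ε : ℚ≥0) : Prop :=
  ∃ τ μ : ℚ≥0, τ + μ ≤ ε ∧ N.S τ (kernel φ) ∧ N.S μ (cokernel φ)

/-- `F` and `G` are `ε`-close. -/
def IsClose (F G : PersFun K) (ε : ℚ≥0) : Prop :=
  ∃ (H : PersFun K) (φ : H ⟶ F) (ψ : H ⟶ G) (τ μ : ℚ≥0), IsTame H ∧
    N.IsEquivalence φ τ ∧ N.IsEquivalence ψ μ ∧ τ + μ ≤ ε

/-- The extended pseudometric on tame functors: the infimum of all `ε` for which `F` and `G` are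
`ε`-close (and `∞` if there is none). -/
noncomputable def pseudoDist (F G : PersFun K) : ℝ≥0∞ :=
  ⨅ (ε : ℚ≥0) (_ : N.IsClose F G ε), ((ε : ℝ≥0) : ℝ≥0∞)

/-- The open ball of radius `t` around `F` in the set of tame functors. -/
def ball (F : PersFun K) (t : ℚ≥0) : Set (PersFun K) :=
  {G | IsTame G ∧ N.pseudoDist F G < ((t : ℝ≥0) : ℝ≥0∞)}

/-- The feature counting invariant `bar(F)_t` of `F` with respect to the noise system. The infimum
is taken in the well-ordered set `ℕ∞`, so for `t > 0` it is the minimum of the ranks of the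
functors in the ball of radius `t` around `F`. -/
noncomputable def barInv (F : PersFun K) (t : ℚ≥0) : ℕ∞ :=
  if t = 0 then rank F else ⨅ (G : PersFun K) (_ : G ∈ N.ball F t), rank G

end NoiseSystem

/-! ### Barcodes -/

/-- A decomposition of `F` as a finite direct sum of bars `[wᵢ,uᵢ)` and free functors
`K(vⱼ,-)`. -/
structure BarDecomposition {K : Type u} [Field K] (F : PersFun K) where
  /-- the number of bars -/
  numBars : ℕ
  /-- the number of free functors -/
  numFree : ℕ
  /-- starting points of the bars -/
  w : Fin numBars → ℚ≥0
  /-- end points of the bars -/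
  u : Fin numBars → ℚ≥0
  le : ∀ i, w i ≤ u i
  /-- generators of the free functors -/
  v : Fin numFree → ℚ≥0
  /-- the isomorphism of `F` with the direct sum -/
  iso : F ≅ (⨁ fun i => bar K (le i)) ⊞ (⨁ fun j => freeOne K (v j))

namespace BarDecomposition

variable {K : Type u} [Field K] {F : PersFun K} (D : BarDecomposition F) (N : NoiseSystem K)

/-- `I_t`: the indices of bars that do not lie in `S_ε` for any `ε < t`. -/
def barIndices (t : ℚ≥0) : Set (Fin D.numBars) :=
  {i | ∀ ε : ℚ≥0, ε < t → ¬ N.S ε (bar K (D.le i))}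

/-- `J_t`: the indices of free summands that do not lie in `S_ε` for any `ε < t`. -/
def freeIndices (t : ℚ≥0) : Set (Fin D.numFree) :=
  {j | ∀ ε : ℚ≥0, ε < t → ¬ N.S ε (freeOne K (D.v j))}

end BarDecomposition

end FeatureCounting

/-! Existence of the decomposition. Compactness bounds the degrees of generators and allows only
finitely many new ones in each grid degree, since otherwise an increasing sequence of proper
subfunctors would exhaust `F`. For `n` generators, work in the coefficient space `K^n`: the vectors
supported on generators born by degree `v`, and those among them that are relations in degree `v`,
form two chains of subspaces. Two chains have a common adapted basis (`exists_adapted_basis`). Each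
of its vectors has a birth degree and, if it ever becomes a relation, a death degree, and
contributes one summand (`nonempty_barDecomposition`).

Upper bound. Projecting away all summands that are noise of size below `t` has as kernel a finite
sum of such noise, still of size below `t` by closure under direct sums. What remains is a sum of
nonzero functors on one generator, so its rank is the number of summands (`hasRank_biproduct`).

Lower bound. Let `F ← H → G` exhibit closeness, with `G` on `n` generators. The image of `H` in `G`
again needs at most `n` generators (`exists_lift_generators`); lifting them to `H` and mapping on to
`F` gives a subfunctor of `F` on `n` generators whose cokernel is noise of size below `t`
(`cokernel_comp`). That subfunctor is already detected by at most `n` of the summands of `F`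
(`exists_finset_detecting`). Any other summand meets it trivially, hence embeds into the cokernel
and is noise. So at most `n` summands are features (`ncard_features_le`). -/

namespace FeatureCounting

/-! ### Elements, generators and maps out of free functors and bars. -/

section Basics

variable {K : Type u} [Field K]

/-- The transition map `F a → F b` for `a ≤ b`, extended by zero. -/
noncomputable def push (F : PersFun K) (a b : ℚ≥0) : F.obj a →ₗ[K] F.obj b :=
  if h : a ≤ b then (F.map (homOfLE h)).hom else 0

theorem push_of_le (F : PersFun K) {a b : ℚ≥0} (h : a ≤ b) :
    push F a b = (F.map (homOfLE h)).hom := dif_pos h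

theorem push_of_not_le (F : PersFun K) {a b : ℚ≥0} (h : ¬ a ≤ b) : push F a b = 0 := dif_neg h

theorem push_self (F : PersFun K) (a : ℚ≥0) (x : F.obj a) : push F a a x = x := by
  rw [push_of_le F le_rfl]
  have : homOfLE (le_refl a) = 𝟙 a := rfl
  rw [this, F.map_id]
  rfl

/-- Both inequalities matter: because of the extension by zero, a detour through a degree not above
`a`, or not below `c`, gives `0`. -/
theorem push_push (F : PersFun K) {a b c : ℚ≥0} (hab : a ≤ b) (hbc : b ≤ c) (x : F.obj a) :
    push F b c (push F a b x) = push F a c x := by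
  rw [push_of_le F hab, push_of_le F hbc, push_of_le F (hab.trans hbc),
    ← homOfLE_comp hab hbc, F.map_comp]
  rfl

theorem map_eq_push (F : PersFun K) {a b : ℚ≥0} (f : a ⟶ b) : (F.map f).hom = push F a b :=
  (push_of_le F (leOfHom f)).symm

theorem app_push {F G : PersFun K} (f : F ⟶ G) (a b : ℚ≥0) (x : F.obj a) :
    (f.app b).hom (push F a b x) = push G a b ((f.app a).hom x) := by
  by_cases h : a ≤ b
  · rw [push_of_le F h, push_of_le G h]
    exact ConcreteCategory.congr_hom (f.naturality (homOfLE h)) x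
  · simp [push_of_not_le _ h]

theorem comp_app_hom {F G H : PersFun K} (f : F ⟶ G) (g : G ⟶ H) (v : ℚ≥0) (x : F.obj v) :
    ((f ≫ g).app v).hom x = (g.app v).hom ((f.app v).hom x) := rfl

theorem id_app_hom (F : PersFun K) (v : ℚ≥0) (x : F.obj v) : ((𝟙 F : F ⟶ F).app v).hom x = x := rfl

theorem zero_app_hom (F G : PersFun K) (v : ℚ≥0) (x : F.obj v) :
    ((0 : F ⟶ G).app v).hom x = 0 := rfl

theorem hom_ext_app {F G : PersFun K} {f g : F ⟶ G}
    (h : ∀ v (x : F.obj v), (f.app v).hom x = (g.app v).hom x) : f = g := by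
  ext v x
  exact h v x

theorem epi_iff_app_surjective {F G : PersFun K} (f : F ⟶ G) :
    Epi f ↔ ∀ v, Function.Surjective (f.app v).hom := by
  rw [NatTrans.epi_iff_epi_app]
  exact forall_congr' fun v => ModuleCat.epi_iff_surjective _

theorem mono_iff_app_injective {F G : PersFun K} (f : F ⟶ G) :
    Mono f ↔ ∀ v, Function.Injective (f.app v).hom := by
  rw [NatTrans.mono_iff_mono_app]
  exact forall_congr' fun v => ModuleCat.mono_iff_injective _

theorem isIso_iff_app_bijective {F G : PersFun K} (f : F ⟶ G) :
    IsIso f ↔ ∀ v, Function.Bijective (f.app v).hom := by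
  rw [NatTrans.isIso_iff_isIso_app]
  exact forall_congr' fun v => ConcreteCategory.isIso_iff_bijective _

theorem exact_app (S : ShortComplex (PersFun K)) (hS : S.Exact) (v : ℚ≥0) (y : S.X₂.obj v)
    (hy : (S.g.app v).hom y = 0) : ∃ x, (S.f.app v).hom x = y := by
  have := hS.map ((evaluation ℚ≥0 (ModuleCat.{u} K)).obj v)
  rw [ShortComplex.moduleCat_exact_iff] at this
  exact this y hy

theorem cokernel_app_eq_zero {F G : PersFun K} (f : F ⟶ G) (v : ℚ≥0) (y : G.obj v)
    (hy : ((cokernel.π f).app v).hom y = 0) : ∃ x, (f.app v).hom x = y :=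
  exact_app (ShortComplex.mk f (cokernel.π f) (cokernel.condition f))
    (ShortComplex.exact_of_g_is_cokernel _ (cokernelIsCokernel f)) v y hy

theorem kernel_app_eq_zero {F G : PersFun K} (f : F ⟶ G) (v : ℚ≥0) (y : F.obj v)
    (hy : (f.app v).hom y = 0) : ∃ x, ((kernel.ι f).app v).hom x = y :=
  exact_app (ShortComplex.mk (kernel.ι f) f (kernel.condition f))
    (ShortComplex.exact_of_f_is_kernel _ (kernelIsKernel f)) v y hy

/-- The family of homogeneous elements `x i` generates `F`. -/
def Generates {ι : Type*} (F : PersFun K) (a : ι → ℚ≥0) (x : ∀ i, F.obj (a i)) : Prop :=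
  ∀ v, Submodule.span K (Set.range fun i => push F (a i) v (x i)) = ⊤

theorem Generates.map {ι : Type*} {F G : PersFun K} {a : ι → ℚ≥0} {x : ∀ i, F.obj (a i)}
    (h : Generates F a x) (f : F ⟶ G) [Epi f] :
    Generates G a fun i => (f.app (a i)).hom (x i) := by
  intro v
  have h1 := congrArg (Submodule.map (f.app v).hom) (h v)
  rw [Submodule.map_top, LinearMap.range_eq_top.2 ((epi_iff_app_surjective f).1 inferInstance v),
    Submodule.map_span, ← Set.range_comp] at h1
  rw [← h1]
  congr 2
  funext i
  exact (app_push f _ _ _).symm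

theorem epi_of_generates {ι : Type*} {F G : PersFun K} {a : ι → ℚ≥0} {x : ∀ i, G.obj (a i)}
    (h : Generates G a x) (f : F ⟶ G) (y : ∀ i, F.obj (a i))
    (hy : ∀ i, (f.app (a i)).hom (y i) = x i) : Epi f := by
  rw [epi_iff_app_surjective]
  intro v
  rw [← LinearMap.range_eq_top, eq_top_iff, ← h v, Submodule.span_le]
  rintro _ ⟨i, rfl⟩
  exact ⟨push F (a i) v (y i), by rw [app_push, hy]⟩

theorem Generates.hom_ext {ι : Type*} {F G : PersFun K} {a : ι → ℚ≥0} {x : ∀ i, F.obj (a i)}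
    (h : Generates F a x) {f g : F ⟶ G}
    (hfg : ∀ i, (f.app (a i)).hom (x i) = (g.app (a i)).hom (x i)) : f = g := by
  refine hom_ext_app fun v y => ?_
  have : (f.app v).hom = (g.app v).hom := by
    refine LinearMap.ext_on_range (h v) fun i => ?_
    rw [app_push, app_push, hfg]
  rw [this]

/-! ### Free functors -/

/-- The generator of `K(v,-)`. -/
noncomputable def freeGen (K : Type u) [Field K] (v : ℚ≥0) : (freeOne K v).obj v :=
  ModuleCat.freeMk (ULift.up (𝟙 v))

/-- The map `K(v,-) ⟶ F` corresponding to an element of `F v`. -/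
noncomputable def freeDesc {F : PersFun K} {v : ℚ≥0} (x : F.obj v) : freeOne K v ⟶ F where
  app b := ModuleCat.freeDesc (↾fun f : ULift (v ⟶ b) => (F.map f.down).hom x)
  naturality a b g := by
    refine ModuleCat.free_hom_ext fun f => ?_
    dsimp [freeOne]
    rw [ModuleCat.free_map_apply, ModuleCat.freeDesc_apply, ModuleCat.freeDesc_apply]
    change (F.map (f.down ≫ g)).hom x = (F.map g).hom ((F.map f.down).hom x)
    rw [F.map_comp]
    rfl

theorem freeDesc_gen {F : PersFun K} {v : ℚ≥0} (x : F.obj v) :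
    ((freeDesc x).app v).hom (freeGen K v) = x := by
  refine (ModuleCat.freeDesc_apply _ _).trans ?_
  change (F.map (𝟙 v)).hom x = x
  rw [F.map_id]
  rfl

theorem push_freeGen {v b : ℚ≥0} (h : v ≤ b) :
    push (freeOne K v) v b (freeGen K v) = ModuleCat.freeMk (ULift.up (homOfLE h)) := by
  rw [push_of_le _ h]
  exact ModuleCat.free_map_apply _ _

theorem generates_freeGen (v : ℚ≥0) :
    Generates (ι := Unit) (freeOne K v) (fun _ => v) (fun _ => freeGen K v) := by
  intro b
  rw [eq_top_iff]
  intro x _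
  change (ULift (v ⟶ b) →₀ K) at x
  induction x using Finsupp.induction_linear with
  | zero => exact zero_mem _
  | add f g hf hg => exact add_mem (hf trivial) (hg trivial)
  | single i c =>
    have : (Finsupp.single i c : ULift (v ⟶ b) →₀ K)
        = c • (push (freeOne K v) v b (freeGen K v) : ULift (v ⟶ b) →₀ K) := by
      rw [push_freeGen (leOfHom i.down)]
      refine Eq.trans ?_ (Finsupp.smul_single c _ _).symm
      rw [smul_eq_mul, mul_one]
      rfl
    rw [this]
    exact Submodule.smul_mem _ _ (Submodule.subset_span ⟨(), rfl⟩)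

theorem push_freeGen_ne_zero {v b : ℚ≥0} (h : v ≤ b) :
    push (freeOne K v) v b (freeGen K v) ≠ 0 := by
  rw [push_freeGen h]
  exact Finsupp.single_ne_zero.2 one_ne_zero

theorem freeOne_eq_smul {v b : ℚ≥0} (x : (freeOne K v).obj b) :
    ∃ c : K, x = c • push (freeOne K v) v b (freeGen K v) := by
  have := (generates_freeGen (K := K) v b).ge (Submodule.mem_top (x := x))
  rw [Set.range_const, Submodule.mem_span_singleton] at this
  obtain ⟨c, hc⟩ := this
  exact ⟨c, hc.symm⟩

theorem freeOne_eq_zero {v b : ℚ≥0} (h : ¬ v ≤ b) (x : (freeOne K v).obj b) : x = 0 := by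
  obtain ⟨c, hc⟩ := freeOne_eq_smul x
  rw [hc, push_of_not_le _ h, LinearMap.zero_apply, smul_zero]

theorem freeOneIncl_gen {w u : ℚ≥0} (h : w ≤ u) :
    ((freeOneIncl K h).app u).hom (freeGen K u) = push (freeOne K w) w u (freeGen K w) := by
  rw [push_freeGen h]
  exact ModuleCat.free_map_apply _ _

/-! ### Bars -/

/-- The projection `K(w,-) ⟶ [w,u)`. -/
noncomputable def barProj (K : Type u) [Field K] {w u : ℚ≥0} (h : w ≤ u) :
    freeOne K w ⟶ bar K h :=
  cokernel.π (freeOneIncl K h)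

instance {w u : ℚ≥0} (h : w ≤ u) : Epi (barProj K h) :=
  inferInstanceAs (Epi (cokernel.π (freeOneIncl K h)))

theorem freeOneIncl_barProj {w u : ℚ≥0} (h : w ≤ u) : freeOneIncl K h ≫ barProj K h = 0 :=
  cokernel.condition _

/-- The generator of `[w,u)`. -/
noncomputable def barGen (K : Type u) [Field K] {w u : ℚ≥0} (h : w ≤ u) : (bar K h).obj w :=
  ((barProj K h).app w).hom (freeGen K w)

theorem generates_barGen {w u : ℚ≥0} (h : w ≤ u) :
    Generates (ι := Unit) (bar K h) (fun _ => w) (fun _ => barGen K h) :=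
  (generates_freeGen (K := K) w).map (barProj K h)

theorem push_barGen_eq_zero {w u b : ℚ≥0} (h : w ≤ u) (hb : u ≤ b) :
    push (bar K h) w b (barGen K h) = 0 := by
  rw [barGen, ← app_push, ← push_push _ h hb, ← freeOneIncl_gen h, ← app_push, ← comp_app_hom,
    freeOneIncl_barProj, zero_app_hom]

/-- The map `[w,u) ⟶ F` corresponding to an element of `F w` that vanishes in `F u`. -/
noncomputable def barDesc {F : PersFun K} {w u : ℚ≥0} (h : w ≤ u) (x : F.obj w)
    (hx : push F w u x = 0) : bar K h ⟶ F :=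
  cokernel.desc _ (freeDesc x) ((generates_freeGen u).hom_ext fun _ => by
    rw [comp_app_hom, freeOneIncl_gen, app_push, freeDesc_gen, hx, zero_app_hom])

theorem barDesc_gen {F : PersFun K} {w u : ℚ≥0} (h : w ≤ u) (x : F.obj w)
    (hx : push F w u x = 0) : ((barDesc h x hx).app w).hom (barGen K h) = x := by
  have : barProj K h ≫ barDesc h x hx = freeDesc x := cokernel.π_desc _ _ _
  rw [barGen, ← comp_app_hom, this, freeDesc_gen]

end Basics

/-! ### Generators of finite direct sums. -/

section Biproducts

variable {K : Type u} [Field K]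

theorem biproduct_sum_app {ι : Type} [Fintype ι] (B : ι → PersFun K) (v : ℚ≥0)
    (z : (⨁ B).obj v) :
    z = ∑ i, ((biproduct.ι B i).app v).hom (((biproduct.π B i).app v).hom z) := by
  have h := congrArg (fun f : (⨁ B) ⟶ ⨁ B => (NatTrans.app f v).hom z)
    (biproduct.total (f := B))
  have h2 : ((∑ i, biproduct.π B i ≫ biproduct.ι B i).app v).hom z
      = ∑ i, ((biproduct.π B i ≫ biproduct.ι B i).app v).hom z := by
    rw [NatTrans.app_sum, ModuleCat.hom_sum, LinearMap.sum_apply]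
  exact (h2.symm.trans h).symm

theorem generates_biproduct {ι : Type} [Fintype ι] (B : ι → PersFun K) (a : ι → ℚ≥0)
    (x : ∀ i, (B i).obj (a i))
    (h : ∀ i, Generates (ι := Unit) (B i) (fun _ => a i) fun _ => x i) :
    Generates (⨁ B) a fun i => ((biproduct.ι B i).app (a i)).hom (x i) := by
  intro v
  rw [eq_top_iff]
  intro z _
  rw [biproduct_sum_app B v z]
  refine sum_mem fun i _ => ?_
  have h1 := (h i v).ge (Submodule.mem_top (x := ((biproduct.π B i).app v).hom z))
  rw [Set.range_const, Submodule.mem_span_singleton] at h1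
  obtain ⟨c, hc⟩ := h1
  rw [← hc, map_smul, app_push]
  exact Submodule.smul_mem _ _ (Submodule.subset_span ⟨i, rfl⟩)

end Biproducts

/-! ### Tameness on a fixed grid, and its permanence properties. -/

section Tame

variable {K : Type u} [Field K]

/-- `G` is constant on the half-open intervals of the grid `α ℕ`. -/
def TameOn {C : Type*} [Category C] (α : ℚ≥0) (G : ℚ≥0 ⥤ C) : Prop :=
  ∀ ⦃a b : ℚ≥0⦄ (f : a ⟶ b), gridFloor α a = gridFloor α b → IsIso (G.map f)

theorem gridFloor_mul {α : ℚ≥0} (hα : 0 < α) (n : ℕ) : gridFloor α (α * n) = n := by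
  rw [gridFloor, mul_div_cancel_left₀ _ hα.ne', Nat.floor_natCast]

theorem mul_gridFloor_le {α : ℚ≥0} (hα : 0 < α) (v : ℚ≥0) : α * (gridFloor α v : ℚ≥0) ≤ v :=
  (isGreatest_gridFloor hα v).1

theorem mul_le_iff_le_gridFloor {α : ℚ≥0} (hα : 0 < α) {n : ℕ} {v : ℚ≥0} :
    α * (n : ℚ≥0) ≤ v ↔ n ≤ gridFloor α v := by
  refine ⟨fun h => (isGreatest_gridFloor hα v).2 h, fun h => ?_⟩
  refine le_trans ?_ (mul_gridFloor_le hα v)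
  gcongr

theorem isTame_of_tameOn {C : Type*} [Category C] {α : ℚ≥0} (hα : 0 < α) {G : ℚ≥0 ⥤ C}
    (h : TameOn α G) : IsTame G := by
  have hm : Monotone fun n : ℕ => α * (n : ℚ≥0) := fun m n hmn => by
    dsimp only
    gcongr
  have hi : ∀ v : ℚ≥0, IsIso (G.map (homOfLE (mul_gridFloor_le hα v))) := fun v =>
    h _ (gridFloor_mul hα _)
  let e : gridExtend α (hm.functor ⋙ G) ≅ G :=
    NatIso.ofComponents (fun v => @asIso _ _ _ _ (G.map (homOfLE (mul_gridFloor_le hα v))) (hi v))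
      (by
      intro a b f
      exact (G.map_comp (homOfLE (hm (gridFloor_mono α (leOfHom f)))) _).symm.trans
        ((congrArg G.map (Subsingleton.elim _ _)).trans (G.map_comp _ f)))
  exact ⟨α, hα, hm.functor ⋙ G, ⟨e.symm⟩⟩

theorem IsTame.exists_tameOn {C : Type*} [Category C] {G : ℚ≥0 ⥤ C} (h : IsTame G) :
    ∃ α : ℚ≥0, 0 < α ∧ TameOn α G := by
  obtain ⟨α, hα, F, ⟨e⟩⟩ := h
  refine ⟨α, hα, fun a b f hab => ?_⟩
  have h1 : IsIso ((gridExtend α F).map f) := by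
    have : ∀ (m n : ℕ) (g : m ⟶ n), m = n → IsIso (F.map g) := by
      rintro m n g rfl
      have : g = 𝟙 m := Subsingleton.elim _ _
      rw [this]
      infer_instance
    exact this _ _ _ hab
  rw [← NatIso.naturality_2 e f]
  infer_instance

/-- Floors nest: `⌊v/α⌋` is the integer quotient by `k` of `⌊v/(α/k)⌋`, so a cell of the finer grid
lies in a single cell of the coarser one. -/
theorem TameOn.refine {C : Type*} [Category C] {α : ℚ≥0} {G : ℚ≥0 ⥤ C} (h : TameOn α G) {k : ℕ}
    (hk : 0 < k) : TameOn (α / k) G := by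
  intro a b f hab
  refine h f ?_
  have key : ∀ v, gridFloor α v = gridFloor (α / k) v / k := by
    intro v
    rw [gridFloor, gridFloor, ← Nat.floor_div_natCast]
    congr 1
    have : (k : ℚ≥0) ≠ 0 := by positivity
    rw [div_div_eq_mul_div, div_right_comm, mul_div_cancel_right₀ _ this]
  rw [key, key, hab]

theorem exists_common_refinement {α β : ℚ≥0} (hα : 0 < α) (hβ : 0 < β) :
    ∃ k l : ℕ, 0 < k ∧ 0 < l ∧ α / k = β / l := by
  -- Both quotients equal `1 / (α.den * β.den)`.
  refine ⟨α.num * β.den, β.num * α.den, ?_, ?_, ?_⟩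
  · have := NNRat.num_pos.2 hα
    have := β.den_pos
    positivity
  · have := NNRat.num_pos.2 hβ
    have := α.den_pos
    positivity
  · have hα' : (α.den : ℚ≥0) ≠ 0 := by exact_mod_cast α.den_pos.ne'
    have hβ' : (β.den : ℚ≥0) ≠ 0 := by exact_mod_cast β.den_pos.ne'
    have h1 : (α.num : ℚ≥0) = α * α.den := (div_eq_iff hα').1 (NNRat.num_div_den α)
    have h2 : (β.num : ℚ≥0) = β * β.den := (div_eq_iff hβ').1 (NNRat.num_div_den β)
    push_cast
    rw [h1, h2]
    field_simp

/-- Finitely many grids have a common refinement. -/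
theorem exists_tameOn_forall {C : Type*} [Category C] {ι : Type*} [Finite ι] (G : ι → (ℚ≥0 ⥤ C))
    (h : ∀ i, IsTame (G i)) : ∃ α : ℚ≥0, 0 < α ∧ ∀ i, TameOn α (G i) := by
  classical
  have := Fintype.ofFinite ι
  suffices ∀ s : Finset ι, ∃ α : ℚ≥0, 0 < α ∧ ∀ i ∈ s, TameOn α (G i) by
    obtain ⟨α, hα, h⟩ := this Finset.univ
    exact ⟨α, hα, fun i => h i (Finset.mem_univ i)⟩
  intro s
  induction s using Finset.induction_on with
  | empty => exact ⟨1, one_pos, by simp⟩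
  | insert i s _ ih =>
    obtain ⟨α, hα, h1⟩ := ih
    obtain ⟨β, hβ, h2⟩ := (h i).exists_tameOn
    obtain ⟨k, l, hk, hl, hkl⟩ := exists_common_refinement hα hβ
    refine ⟨α / k, by positivity, fun j hj => ?_⟩
    rcases Finset.mem_insert.1 hj with rfl | hj
    · rw [hkl]
      exact h2.refine hl
    · exact (h1 j hj).refine hk

/-- Limits of functors are computed degreewise, so the transition map of the limit is induced by the
isomorphisms between the transition sources and targets of the diagram. -/
theorem TameOn.of_isLimit {C : Type*} [Category C] {J : Type*} [Category J] [HasLimitsOfShape J C]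
    {α : ℚ≥0} {D : J ⥤ (ℚ≥0 ⥤ C)} (c : Cone D) (hc : IsLimit c)
    (h : ∀ j, TameOn α (D.obj j)) : TameOn α c.pt := by
  intro a b f hab
  have hiso : ∀ j, IsIso ((D.obj j).map f) := fun j => h j f hab
  let e : D ⋙ (evaluation ℚ≥0 C).obj a ≅ D ⋙ (evaluation ℚ≥0 C).obj b :=
    NatIso.ofComponents (fun j => asIso ((D.obj j).map f)) (by intros; simp)
  let ha := isLimitOfPreserves ((evaluation ℚ≥0 C).obj a) hc
  let hb := isLimitOfPreserves ((evaluation ℚ≥0 C).obj b) hc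
  have : c.pt.map f = (ha.conePointsIsoOfNatIso hb e).hom := by
    refine hb.hom_ext fun j => ?_
    rw [IsLimit.conePointsIsoOfNatIso_hom_comp]
    exact (c.π.app j).naturality f
  rw [this]
  infer_instance

theorem TameOn.of_isColimit {C : Type*} [Category C] {J : Type*} [Category J]
    [HasColimitsOfShape J C]
    {α : ℚ≥0} {D : J ⥤ (ℚ≥0 ⥤ C)} (c : Cocone D) (hc : IsColimit c)
    (h : ∀ j, TameOn α (D.obj j)) : TameOn α c.pt := by
  intro a b f hab
  have hiso : ∀ j, IsIso ((D.obj j).map f) := fun j => h j f hab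
  let e : D ⋙ (evaluation ℚ≥0 C).obj a ≅ D ⋙ (evaluation ℚ≥0 C).obj b :=
    NatIso.ofComponents (fun j => asIso ((D.obj j).map f)) (by intros; simp)
  let ha := isColimitOfPreserves ((evaluation ℚ≥0 C).obj a) hc
  let hb := isColimitOfPreserves ((evaluation ℚ≥0 C).obj b) hc
  have : c.pt.map f = (ha.coconePointsIsoOfNatIso hb e).hom := by
    refine ha.hom_ext fun j => ?_
    rw [IsColimit.comp_coconePointsIsoOfNatIso_hom]
    exact ((c.ι.app j).naturality f).symm
  rw [this]
  infer_instance

theorem TameOn.kernel {α : ℚ≥0} {F G : PersFun K} (hF : TameOn α F) (hG : TameOn α G)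
    (f : F ⟶ G) : TameOn α (kernel f) :=
  TameOn.of_isLimit _ (limit.isLimit (parallelPair f 0)) (by rintro (_ | _) <;> assumption)

theorem TameOn.cokernel {α : ℚ≥0} {F G : PersFun K} (hF : TameOn α F) (hG : TameOn α G)
    (f : F ⟶ G) : TameOn α (cokernel f) :=
  TameOn.of_isColimit _ (colimit.isColimit (parallelPair f 0)) (by rintro (_ | _) <;> assumption)

theorem TameOn.biproduct {α : ℚ≥0} {ι : Type} [Fintype ι] {B : ι → PersFun K}
    (h : ∀ i, TameOn α (B i)) : TameOn α (⨁ B) :=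
  TameOn.of_isLimit _ (biproduct.isLimit B) fun ⟨i⟩ => h i

theorem exists_tameOn_pair {F G : PersFun K} (hF : IsTame F) (hG : IsTame G) :
    ∃ α : ℚ≥0, 0 < α ∧ TameOn α F ∧ TameOn α G := by
  obtain ⟨α, hα, h⟩ := exists_tameOn_forall (fun b : Bool => cond b F G)
    (by rintro (_ | _) <;> assumption)
  exact ⟨α, hα, h true, h false⟩

theorem IsTame.kernel {F G : PersFun K} (hF : IsTame F) (hG : IsTame G) (f : F ⟶ G) :
    IsTame (kernel f) := by
  obtain ⟨α, hα, h1, h2⟩ := exists_tameOn_pair hF hG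
  exact isTame_of_tameOn hα (h1.kernel h2 f)

theorem IsTame.cokernel {F G : PersFun K} (hF : IsTame F) (hG : IsTame G) (f : F ⟶ G) :
    IsTame (cokernel f) := by
  obtain ⟨α, hα, h1, h2⟩ := exists_tameOn_pair hF hG
  exact isTame_of_tameOn hα (h1.cokernel h2 f)

theorem IsTame.biproduct {ι : Type} [Fintype ι] {B : ι → PersFun K}
    (h : ∀ i, IsTame (B i)) : IsTame (⨁ B) := by
  obtain ⟨α, hα, h⟩ := exists_tameOn_forall B h
  exact isTame_of_tameOn hα (TameOn.biproduct h)

theorem tameOn_freeOne {α : ℚ≥0} (hα : 0 < α) (m : ℕ) : TameOn α (freeOne K (α * m)) := by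
  intro a b f hab
  have : ∀ {v : ℚ≥0}, α * m ≤ v ↔ m ≤ gridFloor α v := mul_le_iff_le_gridFloor hα
  have h1 : α * (m : ℚ≥0) ≤ a ↔ α * (m : ℚ≥0) ≤ b := by rw [this, this, hab]
  rw [ConcreteCategory.isIso_iff_bijective]
  have hs := generates_freeGen (K := K) (α * m)
  by_cases h : α * (m : ℚ≥0) ≤ a
  · have hp : ∀ x : (freeOne K (α * m)).obj a, ((freeOne K (α * m)).map f).hom x = push _ a b x :=
      fun x => by rw [map_eq_push]
    constructor
    · refine (injective_iff_map_eq_zero ((freeOne K (α * m)).map f).hom).2 fun x hx => ?_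
      obtain ⟨c, rfl⟩ := freeOne_eq_smul x
      rw [hp, map_smul, push_push _ h (leOfHom f)] at hx
      rw [(smul_eq_zero.1 hx).resolve_right (push_freeGen_ne_zero (h1.1 h)), zero_smul]
    · intro x
      obtain ⟨c, rfl⟩ := freeOne_eq_smul x
      refine ⟨c • push _ _ a (freeGen K (α * m)), (hp _).trans ?_⟩
      rw [map_smul, push_push _ h (leOfHom f)]
  · constructor
    · intro x y _
      rw [freeOne_eq_zero h x, freeOne_eq_zero h y]
    · intro x
      refine ⟨0, ?_⟩
      rw [freeOne_eq_zero (fun h' => h (h1.2 h')) x]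
      exact map_zero ((freeOne K (α * m)).map f).hom

theorem isTame_freeOne (v : ℚ≥0) : IsTame (freeOne K v) := by
  rcases eq_or_ne v 0 with rfl | hv
  · have := tameOn_freeOne (K := K) one_pos 0
    rw [Nat.cast_zero, mul_zero] at this
    exact isTame_of_tameOn one_pos this
  · have hv := pos_iff_ne_zero.2 hv
    have := tameOn_freeOne (K := K) hv 1
    rw [Nat.cast_one, mul_one] at this
    exact isTame_of_tameOn hv this

theorem isTame_bar {w u : ℚ≥0} (h : w ≤ u) : IsTame (bar K h) :=
  (isTame_freeOne u).cokernel (isTame_freeOne w) _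

theorem TameOn.push_bijective {α : ℚ≥0} (hα : 0 < α) {F : PersFun K} (h : TameOn α F) (v : ℚ≥0) :
    Function.Bijective (push F (α * gridFloor α v) v) := by
  rw [push_of_le F (mul_gridFloor_le hα v)]
  have := h (homOfLE (mul_gridFloor_le hα v)) (gridFloor_mul hα _)
  exact (ConcreteCategory.isIso_iff_bijective _).1 this

/-- Tameness of `K(a,-)` on the grid serves as the condition that `a` is a grid point: the nonzero
generator in degree `v` must come from the grid point below `v`, where the functor would vanish if
`a` were larger. -/
theorem le_grid_of_tameOn_freeOne {α : ℚ≥0} (hα : 0 < α) {a : ℚ≥0} (h : TameOn α (freeOne K a))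
    {v : ℚ≥0} (hv : a ≤ v) : a ≤ α * gridFloor α v := by
  by_contra hn
  obtain ⟨y, hy⟩ := (h.push_bijective hα v).2 (push _ a v (freeGen K a))
  rw [freeOne_eq_zero hn y, map_zero] at hy
  exact push_freeGen_ne_zero hv hy.symm

/-- A nonempty set of degrees that is stable under rounding down to a grid and under going up has
a least element. -/
theorem exists_isLeast_of_grid {α : ℚ≥0} (hα : 0 < α) {S : Set ℚ≥0} (hne : S.Nonempty)
    (hS : ∀ v ∈ S, α * (gridFloor α v : ℚ≥0) ∈ S) : ∃ v, IsLeast S v := by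
  classical
  have hex : ∃ n : ℕ, α * (n : ℚ≥0) ∈ S := hne.elim fun v hv => ⟨_, hS v hv⟩
  refine ⟨α * Nat.find hex, Nat.find_spec hex, fun v hv => ?_⟩
  exact (mul_le_iff_le_gridFloor hα).2 (Nat.find_min' hex (hS v hv))

end Tame

/-! ### A basis adapted to two chains of subspaces. -/

section Adapted

variable {K V : Type*} [Field K] [AddCommGroup V] [Module K V] [FiniteDimensional K V]

/-- Induction on `U`: extend an adapted family of a hyperplane `U'` by one vector `x`. The
hyperplane is chosen for `C` and the vector for `D`, so the two choices do not interfere. -/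
theorem exists_adapted_family {C D : Set (Submodule K V)} (hC : IsChain (· ≤ ·) C)
    (hD : IsChain (· ≤ ·) D) (U : Submodule K V) :
    ∃ (n : ℕ) (b : Fin n → V), LinearIndependent K b ∧ Submodule.span K (Set.range b) = U ∧
      ∀ W ∈ C ∪ D, W ⊓ U ≤ Submodule.span K (b '' {i | b i ∈ W}) := by
  induction U using WellFoundedLT.induction with
  | ind U ih =>
  rcases eq_or_ne U ⊥ with rfl | hU
  · exact ⟨0, Fin.elim0, linearIndependent_empty_type, by simp, by simp⟩
  -- a hyperplane of `U` containing the proper members of `C`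
  obtain ⟨M, ⟨hMU, -⟩, hM⟩ : ∃ M : Submodule K V, (M < U ∧ (M = ⊥ ∨ ∃ W ∈ C, M = W ⊓ U)) ∧
      ∀ W ∈ C, W ⊓ U < U → W ⊓ U ≤ M := by
    obtain ⟨M, hM, hmax⟩ := WellFounded.has_min (wellFounded_gt (α := Submodule K V))
      {M | M < U ∧ (M = ⊥ ∨ ∃ W ∈ C, M = W ⊓ U)} ⟨⊥, bot_lt_iff_ne_bot.2 hU, Or.inl rfl⟩
    refine ⟨M, hM, fun W hW hlt => ?_⟩
    have h1 := hmax (W ⊓ U) ⟨hlt, Or.inr ⟨W, hW, rfl⟩⟩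
    rcases hM.2 with rfl | ⟨W', hW', rfl⟩
    · by_contra hn
      exact h1 (bot_lt_iff_ne_bot.2 fun h => hn (by rw [h]))
    · rcases hC.total hW hW' with h | h
      · exact inf_le_inf_right _ h
      · have h2 : W' ⊓ U ≤ W ⊓ U := inf_le_inf_right _ h
        by_contra hn
        exact h1 (lt_of_le_not_ge h2 hn)
  obtain ⟨U', hMU', hcov⟩ := exists_le_covBy_of_lt hMU
  -- a vector outside the hyperplane in the least possible member of `D`
  obtain ⟨E, ⟨hEU, hEU', -⟩, hE⟩ : ∃ E : Submodule K V,
      (E ≤ U ∧ ¬ E ≤ U' ∧ (E = U ∨ ∃ W ∈ D, E = W ⊓ U)) ∧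
      ∀ W ∈ D, ¬ W ⊓ U ≤ U' → E ≤ W ⊓ U := by
    obtain ⟨E, hE, hmin⟩ := WellFounded.has_min (wellFounded_lt (α := Submodule K V))
      {E | E ≤ U ∧ ¬ E ≤ U' ∧ (E = U ∨ ∃ W ∈ D, E = W ⊓ U)}
      ⟨U, le_rfl, fun h => hcov.1.not_ge h, Or.inl rfl⟩
    refine ⟨E, hE, fun W hW hlt => ?_⟩
    have h1 := hmin (W ⊓ U) ⟨inf_le_right, hlt, Or.inr ⟨W, hW, rfl⟩⟩
    rcases hE.2.2 with rfl | ⟨W', hW', rfl⟩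
    · by_contra hn
      exact h1 (lt_of_le_not_ge inf_le_right hn)
    · rcases hD.total hW' hW with h | h
      · exact inf_le_inf_right _ h
      · have h2 : W ⊓ U ≤ W' ⊓ U := inf_le_inf_right _ h
        by_contra hn
        exact h1 (lt_of_le_not_ge h2 hn)
  obtain ⟨x, hxE, hxU'⟩ := Set.not_subset.1 hEU'
  obtain ⟨n, b, hb, hspan, hbW⟩ := ih U' hcov.1
  have hUx : U' ⊔ Submodule.span K {x} = U := by
    refine (hcov.eq_or_eq le_sup_left (sup_le hcov.1.le ?_)).resolve_left fun h => hxU' ?_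
    · rw [Submodule.span_singleton_le_iff_mem]
      exact hEU hxE
    · rw [← h]
      exact Submodule.mem_sup_right (Submodule.mem_span_singleton_self x)
  have hsp : Submodule.span K (Set.range (Fin.cons x b : Fin (n + 1) → V)) = U := by
    rw [Fin.range_cons, Submodule.span_insert, hspan, sup_comm, hUx]
  have himg : ∀ W : Submodule K V, Submodule.span K (b '' {i | b i ∈ W}) ≤
      Submodule.span K ((Fin.cons x b : Fin (n + 1) → V) ''
        {i | (Fin.cons x b : Fin (n + 1) → V) i ∈ W}) := by
    intro W
    refine Submodule.span_mono ?_
    rintro _ ⟨i, hi, rfl⟩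
    exact ⟨i.succ, by simpa using hi, by simp⟩
  refine ⟨n + 1, Fin.cons x b, linearIndependent_finCons.2 ⟨hb, ?_⟩, hsp, fun W hW => ?_⟩
  · rwa [hspan]
  by_cases hWU' : W ⊓ U ≤ U'
  · exact (le_inf inf_le_left hWU').trans ((hbW W hW).trans (himg W))
  -- The trace of `W` on `U` is not inside `U'`. For `W` in `C` it must then be all of `U`; for `W`
  -- in `D` it contains `x`, and subtracting a multiple of `x` leads back to `U'`.
  rcases hW with hWC | hWD
  · have hUW : U ≤ W := by
      by_contra hn
      exact hWU' ((hM W hWC (lt_of_le_of_ne inf_le_right fun h => hn (inf_eq_right.1 h))).trans hMU')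
    rw [inf_eq_right.2 hUW, ← hsp, Submodule.span_le]
    rintro _ ⟨i, rfl⟩
    refine Submodule.subset_span ⟨i, hUW ?_, rfl⟩
    rw [← hsp]
    exact Submodule.subset_span ⟨i, rfl⟩
  · have hxW : x ∈ W := (hE W hWD hWU' hxE).1
    rintro z ⟨hzW, hzU⟩
    rw [SetLike.mem_coe, ← hUx, Submodule.mem_sup] at hzU
    obtain ⟨y, hy, y', hy', rfl⟩ := hzU
    obtain ⟨c, rfl⟩ := Submodule.mem_span_singleton.1 hy'
    refine add_mem (himg W (hbW W (Or.inr hWD) ⟨?_, hy⟩)) (Submodule.smul_mem _ _ ?_)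
    · have := W.sub_mem hzW (W.smul_mem c hxW)
      rwa [add_sub_cancel_right] at this
    · exact Submodule.subset_span ⟨0, by simpa using hxW, by simp⟩

/-- Two chains of subspaces of a finite-dimensional space have a common adapted basis. -/
theorem exists_adapted_basis {C D : Set (Submodule K V)} (hC : IsChain (· ≤ ·) C)
    (hD : IsChain (· ≤ ·) D) {n : ℕ} (hn : Module.finrank K V = n) :
    ∃ b : Module.Basis (Fin n) K V,
      ∀ W ∈ C ∪ D, ∀ z ∈ W, ∀ i, b.repr z i ≠ 0 → b i ∈ W := by
  obtain ⟨m, b, hb, hspan, h⟩ := exists_adapted_family hC hD ⊤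
  let B := Module.Basis.mk hb hspan.ge
  have hm : n = m := by
    rw [← hn, Module.finrank_eq_card_basis B, Fintype.card_fin]
  subst hm
  refine ⟨B, fun W hW z hz i hi => ?_⟩
  have hB : (B : _ → V) = b := Module.Basis.coe_mk _ _
  have h1 := h W hW ⟨hz, trivial⟩
  rw [← hB, Module.Basis.mem_span_image] at h1
  exact h1 (Finsupp.mem_support_iff.2 hi)

end Adapted

/-! ### Coefficient vectors; generators of subfunctors; detection by few summands. -/

section GenMap

variable {K : Type u} [Field K] {ι : Type}

/-- The coefficient vectors supported in the degrees at most `v`. -/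
def liveCoeffs (K : Type u) [Field K] (a : ι → ℚ≥0) (v : ℚ≥0) : Submodule K (ι → K) where
  carrier := {c | ∀ i, ¬ a i ≤ v → c i = 0}
  add_mem' hc hd i hi := by rw [Pi.add_apply, hc i hi, hd i hi, add_zero]
  zero_mem' _ _ := rfl
  smul_mem' r c hc i hi := by rw [Pi.smul_apply, hc i hi, smul_zero]

theorem liveCoeffs_mono (a : ι → ℚ≥0) : Monotone (liveCoeffs K a) :=
  fun _ _ h _ hc i hi => hc i fun h' => hi (h'.trans h)

variable [Fintype ι]

/-- The linear combination of the images in `F v` of homogeneous elements of `F`. -/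
noncomputable def genMap (F : PersFun K) (a : ι → ℚ≥0) (x : ∀ i, F.obj (a i)) (v : ℚ≥0) :
    (ι → K) →ₗ[K] F.obj v :=
  Fintype.linearCombination K fun i => push F (a i) v (x i)

theorem genMap_apply (F : PersFun K) (a : ι → ℚ≥0) (x : ∀ i, F.obj (a i)) (v : ℚ≥0) (c : ι → K) :
    genMap F a x v c = ∑ i, c i • push F (a i) v (x i) :=
  Fintype.linearCombination_apply ..

theorem push_genMap (F : PersFun K) (a : ι → ℚ≥0) (x : ∀ i, F.obj (a i)) {v w : ℚ≥0} (h : v ≤ w)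
    {c : ι → K} (hc : c ∈ liveCoeffs K a v) :
    push F v w (genMap F a x v c) = genMap F a x w c := by
  rw [genMap_apply, genMap_apply, map_sum]
  refine Finset.sum_congr rfl fun i _ => ?_
  by_cases hi : a i ≤ v
  · rw [map_smul, push_push F hi h]
  · rw [hc i hi, zero_smul, zero_smul, map_zero]

theorem exists_liveCoeffs (F : PersFun K) (a : ι → ℚ≥0) (x : ∀ i, F.obj (a i)) (v : ℚ≥0)
    (c : ι → K) : ∃ d ∈ liveCoeffs K a v, genMap F a x v d = genMap F a x v c := by
  classical
  refine ⟨fun i => if a i ≤ v then c i else 0, fun i hi => if_neg hi, ?_⟩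
  rw [genMap_apply, genMap_apply]
  refine Finset.sum_congr rfl fun i _ => ?_
  by_cases hi : a i ≤ v
  · rw [if_pos hi]
  · rw [push_of_not_le _ hi, LinearMap.zero_apply, smul_zero, smul_zero]

theorem app_genMap {F G : PersFun K} (f : F ⟶ G) (a : ι → ℚ≥0) (x : ∀ i, F.obj (a i)) (v : ℚ≥0)
    (c : ι → K) : (f.app v).hom (genMap F a x v c)
      = genMap G a (fun i => (f.app (a i)).hom (x i)) v c := by
  rw [genMap_apply, genMap_apply, map_sum]
  exact Finset.sum_congr rfl fun i _ => by rw [map_smul, app_push]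

theorem Generates.exists_genMap {F : PersFun K} {a : ι → ℚ≥0} {x : ∀ i, F.obj (a i)}
    (h : Generates F a x) (v : ℚ≥0) (z : F.obj v) :
    ∃ c ∈ liveCoeffs K a v, genMap F a x v c = z := by
  have h1 := (h v).ge (Submodule.mem_top (x := z))
  rw [← Fintype.range_linearCombination] at h1
  obtain ⟨c, rfl⟩ := h1
  exact exists_liveCoeffs F a x v c

/-- A tame subfunctor of a functor with `n` generators has `n` generators; here lifted along a
map with that image. -/
theorem exists_lift_generators {n : ℕ} {H G : PersFun K} (ψ : H ⟶ G) {α : ℚ≥0} (hα : 0 < α)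
    (hH : TameOn α H) (hG : TameOn α G) {a : Fin n → ℚ≥0} {x : ∀ i, G.obj (a i)}
    (ha : ∀ i, TameOn α (freeOne K (a i))) (hx : Generates G a x) :
    ∃ (w : Fin n → ℚ≥0) (h : ∀ i, H.obj (w i)), ∀ v (y : H.obj v), ∃ c : Fin n → K,
      (ψ.app v).hom (genMap H w h v c) = (ψ.app v).hom y := by
  -- `L v` describes, by live coefficients, the elements of `G v` in the image of `ψ`. These
  -- subspaces increase with `v`, so in an adapted basis each vector enters at one degree, and its
  -- value there lifts to `H`.
  let L : ℚ≥0 → Submodule K (Fin n → K) := fun v =>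
    liveCoeffs K a v ⊓ (LinearMap.range (ψ.app v).hom).comap (genMap G a x v)
  have hL : Monotone L := by
    rintro v w h c ⟨hc, y, hy⟩
    refine ⟨liveCoeffs_mono a h hc, push H v w y, ?_⟩
    rw [app_push, hy, push_genMap G a x h hc]
  have hgrid : ∀ v, ∀ c ∈ L v, c ∈ L (α * gridFloor α v) := by
    rintro v c ⟨hc, y, hy⟩
    have hc' : c ∈ liveCoeffs K a (α * gridFloor α v) := fun i hi =>
      hc i fun h => hi (le_grid_of_tameOn_freeOne hα (ha i) h)
    obtain ⟨y', rfl⟩ := (hH.push_bijective hα v).2 y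
    refine ⟨hc', y', (hG.push_bijective hα v).1 ?_⟩
    rw [← app_push, hy, push_genMap G a x (mul_gridFloor_le hα v) hc']
  obtain ⟨b, hb⟩ := exists_adapted_basis (C := Set.range L) (D := ∅)
    hL.isChain_range (Set.subsingleton_empty.isChain) (Module.finrank_fin_fun K)
  have hchoose : ∀ i, ∃ (w : ℚ≥0) (h : H.obj w), ∀ v, b i ∈ L v →
      w ≤ v ∧ b i ∈ L w ∧ (ψ.app w).hom h = genMap G a x w (b i) := by
    intro i
    by_cases hne : {v | b i ∈ L v}.Nonempty
    · obtain ⟨w, hw, hmin⟩ := exists_isLeast_of_grid hα hne fun v hv => hgrid v _ hv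
      obtain ⟨y, hy⟩ := hw.2
      exact ⟨w, y, fun v hv => ⟨hmin hv, hw, hy⟩⟩
    -- A basis vector that never enters `L` gets an arbitrary lift: it has coefficient zero in every
    -- element of every `L v`.
    · exact ⟨0, 0, fun v hv => absurd ⟨v, hv⟩ hne⟩
  choose w h hwh using hchoose
  refine ⟨w, h, fun v y => ?_⟩
  obtain ⟨c, hc, hcy⟩ := hx.exists_genMap v ((ψ.app v).hom y)
  have hcL : c ∈ L v := ⟨hc, y, hcy.symm⟩
  refine ⟨b.repr c, ?_⟩
  rw [← hcy, genMap_apply, map_sum]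
  conv_rhs => rw [← b.sum_repr c, map_sum]
  refine Finset.sum_congr rfl fun i _ => ?_
  rw [map_smul, map_smul]
  by_cases hi : b.repr c i = 0
  · rw [hi, zero_smul, zero_smul]
  · obtain ⟨h1, h2, h3⟩ := hwh i v (hb (L v) (Or.inl ⟨v, rfl⟩) c hcL i hi)
    rw [app_push, h3, push_genMap G a x h1 h2.1]

/-- A functor with `n` homogeneous generators embeds into a product of `n` of the factors of any
finite product that it embeds into. -/
theorem exists_finset_detecting {F : PersFun K} {B : ι → PersFun K} (π : ∀ i, F ⟶ B i)
    (hπ : ∀ v (z : F.obj v), (∀ i, ((π i).app v).hom z = 0) → z = 0) (n : ℕ)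
    (a : Fin n → ℚ≥0) (x : ∀ k, F.obj (a k)) :
    ∃ A : Finset ι, A.card ≤ n ∧ ∀ v (c : Fin n → K),
      (∀ i ∈ A, ((π i).app v).hom (genMap F a x v c) = 0) → genMap F a x v c = 0 := by
  classical
  induction n with
  | zero => exact ⟨∅, le_rfl, fun v c _ => by rw [genMap_apply, Fin.sum_univ_zero]⟩
  | succ n ih =>
  obtain ⟨A, hA, hdet⟩ := ih (fun k => a k.succ) (fun k => x k.succ)
  set M := genMap F (fun k : Fin n => a k.succ) (fun k => x k.succ) with hM
  have hsucc : ∀ v (c : Fin (n + 1) → K),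
      genMap F a x v c = c 0 • push F (a 0) v (x 0) + M v fun k => c k.succ := by
    intro v c
    rw [hM, genMap_apply, genMap_apply, Fin.sum_univ_succ]
  by_cases hall : ∀ v (c : Fin (n + 1) → K),
      (∀ i ∈ A, ((π i).app v).hom (genMap F a x v c) = 0) → genMap F a x v c = 0
  · exact ⟨A, hA.trans n.le_succ, hall⟩
  suffices ∃ j, ∀ v (c : Fin (n + 1) → K),
      (∀ i ∈ A, ((π i).app v).hom (genMap F a x v c) = 0) →
      ((π j).app v).hom (genMap F a x v c) = 0 → genMap F a x v c = 0 by
    obtain ⟨j, hj⟩ := this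
    refine ⟨insert j A, (Finset.card_insert_le _ _).trans (by omega), fun v c h => hj v c ?_ ?_⟩
    · exact fun i hi => h i (Finset.mem_insert_of_mem hi)
    · exact h j (Finset.mem_insert_self _ _)
  -- Each `j` now has a counterexample killed by `A` and by `π j`. Pushed to the largest degree
  -- involved they become proportional, so the one living there is killed by every projection.
  by_contra! hcon
  choose v c hcA hcj hne using hcon
  have : Nonempty ι := by
    by_contra he
    rw [not_nonempty_iff] at he
    exact hall fun v c _ => hπ v _ fun i => he.elim i
  obtain ⟨i₀, hi₀⟩ := Finite.exists_max v
  -- the coefficients at the new generator do not vanish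
  have hcoef : ∀ i, c i 0 ≠ 0 ∧ a 0 ≤ v i := by
    intro i
    by_contra hn
    have hz : c i 0 • push F (a 0) (v i) (x 0) = 0 := by
      by_cases h0 : c i 0 = 0
      · rw [h0, zero_smul]
      · rw [push_of_not_le F (fun h => hn ⟨h0, h⟩), LinearMap.zero_apply, smul_zero]
    have h1 := hsucc (v i) (c i)
    rw [hz, zero_add] at h1
    exact hne i (h1.trans (hdet _ _ (h1 ▸ hcA i)))
  -- hence all the counterexamples agree up to a scalar in the last degree
  have hprop : ∀ i, genMap F a x (v i₀) (c i₀)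
      = (c i₀ 0 / c i 0) • push F (v i) (v i₀) (genMap F a x (v i) (c i)) := by
    intro i
    -- Coefficients not yet live in degree `v i` must be cleared first: they contribute nothing
    -- there but could contribute in degree `v i₀`.
    obtain ⟨d, hd, hde⟩ := exists_liveCoeffs F (fun k : Fin n => a k.succ) (fun k => x k.succ)
      (v i) fun k => c i k.succ
    have h1 : push F (v i) (v i₀) (genMap F a x (v i) (c i))
        = c i 0 • push F (a 0) (v i₀) (x 0) + M (v i₀) d := by
      rw [hsucc, map_add, map_smul, push_push F (hcoef i).2 (hi₀ i), hM, ← hde,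
        push_genMap F _ _ (hi₀ i) hd]
    have h2 : genMap F a x (v i₀) (c i₀)
        - (c i₀ 0 / c i 0) • push F (v i) (v i₀) (genMap F a x (v i) (c i))
        = M (v i₀) ((fun k => c i₀ k.succ) - (c i₀ 0 / c i 0) • d) := by
      rw [h1, hsucc, map_sub, map_smul, smul_add, smul_smul, div_mul_cancel₀ _ (hcoef i).1]
      abel
    -- Matching the coefficients at the new generator leaves a combination of the old ones, on which
    -- `A` already detects zero.
    refine sub_eq_zero.1 (h2.trans (hdet _ _ fun j hj => ?_))
    rw [← h2, map_sub, map_smul, app_push, hcA i₀ j hj, hcA i j hj, map_zero, smul_zero, sub_zero]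
  refine hne i₀ (hπ _ _ fun i => ?_)
  rw [hprop i, map_smul, app_push, hcj, map_zero, smul_zero]

end GenMap

/-! ### Permanence properties of noise. -/

namespace NoiseSystem

variable {K : Type u} [Field K] (N : NoiseSystem K)

theorem mono' {τ ε : ℚ≥0} (h : τ ≤ ε) {F : PersFun K} (hF : N.S τ F) : N.S ε F := by
  rcases h.eq_or_lt with rfl | h
  · exact hF
  · exact N.mono _ _ h _ hF

theorem of_mono {ε : ℚ≥0} {F G : PersFun K} (f : F ⟶ G) [Mono f] (hF : IsTame F)
    (hG : N.S ε G) : N.S ε F :=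
  N.sub_mem ε (ShortComplex.mk f (cokernel.π f) (cokernel.condition f))
    { exact := ShortComplex.exact_of_g_is_cokernel _ (cokernelIsCokernel f) }
    hF (N.tame _ _ hG) (hF.cokernel (N.tame _ _ hG) f) hG

theorem of_epi {ε : ℚ≥0} {F G : PersFun K} (f : F ⟶ G) [Epi f] (hG : IsTame G)
    (hF : N.S ε F) : N.S ε G :=
  N.quot_mem ε (ShortComplex.mk (kernel.ι f) f (kernel.condition f))
    { exact := ShortComplex.exact_of_f_is_kernel _ (kernelIsKernel f) }
    ((N.tame _ _ hF).kernel hG f) (N.tame _ _ hF) hG hF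

theorem of_kernel {ε τ : ℚ≥0} {F G : PersFun K} (f : F ⟶ G) [Epi f] (hF : IsTame F)
    (hk : N.S ε (kernel f)) (hG : N.S τ G) : N.S (ε + τ) F :=
  N.ext_mem ε τ (ShortComplex.mk (kernel.ι f) f (kernel.condition f))
    { exact := ShortComplex.exact_of_f_is_kernel _ (kernelIsKernel f) }
    (N.tame _ _ hk) hF (N.tame _ _ hG) hk hG

/-- If `H` is generated by the image of `η` and a noise of size `μ`, and the cokernel of
`φ : H ⟶ F` is a noise of size `τ`, then so is `F` modulo the image of `η`, of size `μ + τ`. -/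
theorem cokernel_comp {μ τ : ℚ≥0} {Q H F X : PersFun K} (η : Q ⟶ H) (φ : H ⟶ F) (ι : X ⟶ H)
    [Epi (ι ≫ cokernel.π η)] (hQ : IsTame Q) (hH : IsTame H) (hF : IsTame F)
    (hX : N.S μ X) (hφ : N.S τ (cokernel φ)) : N.S (μ + τ) (cokernel (η ≫ φ)) := by
  have hη : N.S μ (cokernel η) := N.of_epi (ι ≫ cokernel.π η) (hQ.cokernel hH η) hX
  have ht := hQ.cokernel hF (η ≫ φ)
  let m : cokernel η ⟶ cokernel (η ≫ φ) := cokernel.desc η (φ ≫ cokernel.π (η ≫ φ))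
    (by rw [← Category.assoc, cokernel.condition])
  let q : cokernel (η ≫ φ) ⟶ cokernel φ := cokernel.desc _ (cokernel.π φ)
    (by rw [Category.assoc, cokernel.condition, comp_zero])
  have hπm : cokernel.π η ≫ m = φ ≫ cokernel.π (η ≫ φ) := cokernel.π_desc _ _ _
  have hπq : cokernel.π (η ≫ φ) ≫ q = cokernel.π φ := cokernel.π_desc _ _ _
  have : Epi q := epi_of_epi_fac hπq
  have hmq : m ≫ q = 0 := by
    rw [← cancel_epi (cokernel.π η), ← Category.assoc, hπm, Category.assoc, hπq,
      cokernel.condition, comp_zero]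
  -- The kernel of `q` is the image of `φ` modulo that of `η ≫ φ`, hence a quotient of `cokernel η`;
  -- the extension axiom for `q` then gives the bound.
  let l : cokernel η ⟶ kernel q := kernel.lift q m hmq
  have hl : l ≫ kernel.ι q = m := kernel.lift_ι _ _ _
  have : Epi l := by
    rw [epi_iff_app_surjective]
    intro v z
    obtain ⟨y, hy⟩ := (epi_iff_app_surjective (cokernel.π (η ≫ φ))).1 inferInstance v
      (((kernel.ι q).app v).hom z)
    have h1 : ((cokernel.π φ).app v).hom y = 0 := by
      rw [← hπq, comp_app_hom, hy, ← comp_app_hom, kernel.condition, zero_app_hom]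
    obtain ⟨x, rfl⟩ := cokernel_app_eq_zero φ v y h1
    refine ⟨((cokernel.π η).app v).hom x,
      (mono_iff_app_injective (kernel.ι q)).1 inferInstance v ?_⟩
    rw [← comp_app_hom, hl, ← comp_app_hom, hπm, comp_app_hom, hy]
  exact N.of_kernel q ht (N.of_epi l (ht.kernel (N.tame _ _ hφ) q) hη) hφ

end NoiseSystem

/-! ### Rank of a direct sum of functors on one generator. -/

variable {K : Type u} [Field K]

theorem HasRank.exists_generates {G : PersFun K} {n : ℕ} (h : HasRank G n) :
    ∃ (a : Fin n → ℚ≥0) (x : ∀ i, G.obj (a i)), Generates G a x := by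
  obtain ⟨a, φ, hφ, -⟩ := h
  exact ⟨a, _, (generates_biproduct _ a (fun i => freeGen K (a i))
    fun i => generates_freeGen (a i)).map φ⟩

/-- A direct sum of `n` nonzero functors on one generator has rank `n`. -/
theorem hasRank_biproduct {n : ℕ} {B : Fin n → PersFun K} {w : Fin n → ℚ≥0}
    (q : ∀ k, freeOne K (w k) ⟶ B k) [∀ k, Epi (q k)] (hB : ∀ k, ¬ IsZero (B k)) :
    HasRank (⨁ B) n := by
  have hP := generates_biproduct (fun k => freeOne K (w k)) w (fun i => freeGen K (w i))
    fun i => generates_freeGen (w i)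
  set g := fun k => ((biproduct.ι (fun k => freeOne K (w k)) k).app (w k)).hom (freeGen K (w k))
    with hg
  have hq : ∀ k, ((q k).app (w k)).hom (freeGen K (w k)) ≠ 0 := by
    intro k h0
    refine hB k ?_
    have : q k = 0 := (generates_freeGen (w k)).hom_ext fun _ => by rw [h0, zero_app_hom]
    rw [IsZero.iff_id_eq_zero, ← cancel_epi (q k), this, zero_comp, zero_comp]
  refine ⟨w, biproduct.map q, ?_, fun f hf => ?_⟩
  · refine epi_of_generates (generates_biproduct B w
      (fun k => ((q k).app (w k)).hom (freeGen K (w k)))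
      fun k => (generates_freeGen (w k)).map (q k)) _ g fun k => ?_
    rw [hg, ← comp_app_hom, biproduct.ι_map, comp_app_hom]
  -- Induction on the degree of the generator. The error `f g - g` lies in the sum of the kernels of
  -- the `q j`: its components along generators of lower degree are in the range by induction, and
  -- the others vanish, as `q j` is nonzero on its generator.
  have hmem : ∀ k, ∃ y, (f.app (w k)).hom y = g k := by
    let r : Fin n → Fin n → Prop := fun j k => w j < w k
    have : IsTrans (Fin n) r := ⟨fun _ _ _ => lt_trans⟩
    have : Std.Irrefl r := ⟨fun _ => lt_irrefl _⟩
    intro k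
    induction k using (Finite.wellFounded_of_trans_of_irrefl r).induction with
    | _ k ih =>
    set d := (f.app (w k)).hom (g k) - g k with hd
    suffices d ∈ LinearMap.range (f.app (w k)).hom by
      obtain ⟨y, hy⟩ := this
      exact ⟨g k - y, by rw [map_sub, hy, hd, sub_sub_cancel]⟩
    rw [biproduct_sum_app _ _ d]
    refine sum_mem fun j _ => ?_
    have hdj : ((q j).app (w k)).hom
        (((biproduct.π (fun k => freeOne K (w k)) j).app (w k)).hom d) = 0 := by
      rw [← comp_app_hom, ← biproduct.map_π, comp_app_hom, hd, map_sub, ← comp_app_hom, hf,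
        sub_self, map_zero]
    obtain ⟨c, hc⟩ := freeOne_eq_smul (((biproduct.π (fun k => freeOne K (w k)) j).app (w k)).hom d)
    rw [hc] at hdj ⊢
    rw [map_smul, app_push]
    by_cases hlt : w j < w k
    · obtain ⟨y, hy⟩ := ih j hlt
      refine Submodule.smul_mem _ _ ⟨push _ (w j) (w k) y, ?_⟩
      rw [app_push, hy]
    · by_cases hc0 : c = 0
      · rw [hc0, zero_smul]
        exact zero_mem _
      by_cases hle : w j ≤ w k
      · exfalso
        rw [map_smul, app_push] at hdj
        -- The two degrees agree here; pushing back replaces a transport along their equality.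
        have h1 := congrArg (push (B j) (w k) (w j)) ((smul_eq_zero.1 hdj).resolve_left hc0)
        rw [push_push _ hle (not_lt.1 hlt), push_self, map_zero] at h1
        exact hq j h1
      · rw [push_of_not_le _ hle, LinearMap.zero_apply, smul_zero]
        exact zero_mem _
  choose y hy using hmem
  have hepi : Epi f := epi_of_generates hP f y hy
  rw [isIso_iff_app_bijective]
  intro v
  have hs := (epi_iff_app_surjective f).1 hepi v
  have : Module.Finite K ((⨁ fun k => freeOne K (w k)).obj v) :=
    ⟨Submodule.fg_def.2 ⟨_, Set.finite_range _, hP v⟩⟩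
  -- A surjective endomorphism of a finite-dimensional space is injective, degree by degree.
  exact ⟨LinearMap.injective_iff_surjective.2 hs, hs⟩

/-! ### Summands of a decomposition, and the lower bound. -/

namespace BarDecomposition

variable {F : PersFun K} (D : BarDecomposition F)

/-- The summands of a decomposition. -/
noncomputable def summand : Fin D.numBars ⊕ Fin D.numFree → PersFun K
  | .inl i => bar K (D.le i)
  | .inr j => freeOne K (D.v j)

/-- The degrees of the generators of the summands. -/
def deg : Fin D.numBars ⊕ Fin D.numFree → ℚ≥0
  | .inl i => D.w i
  | .inr j => D.v j

/-- The cover of a summand by a free functor on one generator. -/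
noncomputable def cover : ∀ s, freeOne K (D.deg s) ⟶ D.summand s
  | .inl i => barProj K (D.le i)
  | .inr j => 𝟙 (freeOne K (D.v j))

instance (s) : Epi (D.cover s) := by
  rcases s with i | j
  · exact inferInstanceAs (Epi (barProj K (D.le i)))
  · exact inferInstanceAs (Epi (𝟙 (freeOne K (D.v j))))

/-- The projection to a summand. -/
noncomputable def proj : ∀ s, F ⟶ D.summand s
  | .inl i => D.iso.hom ≫ biprod.fst ≫ biproduct.π _ i
  | .inr j => D.iso.hom ≫ biprod.snd ≫ biproduct.π _ j

/-- The inclusion of a summand. -/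
noncomputable def incl : ∀ s, D.summand s ⟶ F
  | .inl i => biproduct.ι (fun i => bar K (D.le i)) i ≫ biprod.inl ≫ D.iso.inv
  | .inr j => biproduct.ι (fun j => freeOne K (D.v j)) j ≫ biprod.inr ≫ D.iso.inv

theorem incl_proj_self (s) : D.incl s ≫ D.proj s = 𝟙 _ := by
  rcases s with i | j
  · change (biproduct.ι (fun i => bar K (D.le i)) i ≫ biprod.inl ≫ D.iso.inv) ≫
      D.iso.hom ≫ biprod.fst ≫ biproduct.π (fun i => bar K (D.le i)) i = 𝟙 (bar K (D.le i))
    simp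
  · change (biproduct.ι (fun j => freeOne K (D.v j)) j ≫ biprod.inr ≫ D.iso.inv) ≫
      D.iso.hom ≫ biprod.snd ≫ biproduct.π (fun j => freeOne K (D.v j)) j = 𝟙 (freeOne K (D.v j))
    simp

theorem incl_proj_ne {s s'} (h : s ≠ s') : D.incl s ≫ D.proj s' = 0 := by
  rcases s with i | j <;> rcases s' with i' | j'
  · change (biproduct.ι (fun i => bar K (D.le i)) i ≫ biprod.inl ≫ D.iso.inv) ≫
      D.iso.hom ≫ biprod.fst ≫ biproduct.π (fun i => bar K (D.le i)) i' = 0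
    have h' : i ≠ i' := fun h' => h (congrArg _ h')
    simp [biproduct.ι_π_ne _ h']
  · change (biproduct.ι (fun i => bar K (D.le i)) i ≫ biprod.inl ≫ D.iso.inv) ≫
      D.iso.hom ≫ biprod.snd ≫ biproduct.π (fun j => freeOne K (D.v j)) j' = 0
    simp
  · change (biproduct.ι (fun j => freeOne K (D.v j)) j ≫ biprod.inr ≫ D.iso.inv) ≫
      D.iso.hom ≫ biprod.fst ≫ biproduct.π (fun i => bar K (D.le i)) i' = 0
    simp
  · change (biproduct.ι (fun j => freeOne K (D.v j)) j ≫ biprod.inr ≫ D.iso.inv) ≫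
      D.iso.hom ≫ biprod.snd ≫ biproduct.π (fun j => freeOne K (D.v j)) j' = 0
    have h' : j ≠ j' := fun h' => h (congrArg _ h')
    simp [biproduct.ι_π_ne _ h']

theorem proj_ext {G : PersFun K} {f g : G ⟶ F} (h : ∀ s, f ≫ D.proj s = g ≫ D.proj s) :
    f = g := by
  rw [← cancel_mono D.iso.hom]
  refine biprod.hom_ext _ _ (biproduct.hom_ext _ _ fun i => ?_) (biproduct.hom_ext _ _ fun j => ?_)
  · simp only [Category.assoc]
    exact h (.inl i)
  · simp only [Category.assoc]
    exact h (.inr j)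

theorem eq_zero_of_proj {v : ℚ≥0} {z : F.obj v} (h : ∀ s, ((D.proj s).app v).hom z = 0) :
    z = 0 := by
  have h0 : freeDesc z = 0 := D.proj_ext fun s => (generates_freeGen v).hom_ext fun _ => by
    rw [comp_app_hom, freeDesc_gen, h, zero_comp, zero_app_hom]
  rw [← freeDesc_gen z, h0, zero_app_hom]

theorem isTame_summand (s) : IsTame (D.summand s) := by
  rcases s with i | j
  · exact isTame_bar _
  · exact isTame_freeOne _

variable (N : NoiseSystem K)

/-- The summands that are not noise of any size less than `t`. -/
def features (t : ℚ≥0) : Set (Fin D.numBars ⊕ Fin D.numFree) :=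
  {s | ∀ ε, ε < t → ¬ N.S ε (D.summand s)}

theorem ncard_features (t : ℚ≥0) :
    (D.features N t).ncard = (D.barIndices N t).ncard + (D.freeIndices N t).ncard := by
  have h : D.features N t = Sum.inl '' D.barIndices N t ∪ Sum.inr '' D.freeIndices N t := by
    ext (i | j)
    · simp [features, barIndices, summand]
    · simp [features, freeIndices, summand]
  rw [h, Set.ncard_union_eq, Set.ncard_image_of_injective _ Sum.inl_injective,
    Set.ncard_image_of_injective _ Sum.inr_injective]
  rw [Set.disjoint_left]
  rintro _ ⟨i, _, rfl⟩ ⟨j, _, h⟩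
  cases h

variable {N}

/-- Holds for every `n` for which a minimal cover exists, so the infimum defining `rank` is bounded
without uniqueness of minimal covers. -/
theorem ncard_features_le (hF : IsTame F) {G : PersFun K} (hG : IsTame G) {ε t : ℚ≥0}
    (hε : ε < t) (h : N.IsClose F G ε) {n : ℕ} (hn : HasRank G n) :
    (D.features N t).ncard ≤ n := by
  obtain ⟨H, φ, ψ, τ, μ, hH, ⟨τ₁, τ₂, hτ, -, hφ⟩, ⟨μ₁, μ₂, hμ, hψ, -⟩, hle⟩ := h
  obtain ⟨a, x, hx⟩ := hn.exists_generates
  obtain ⟨α, hα, hα'⟩ := exists_tameOn_forall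
    (Sum.elim (fun b : Bool => cond b H G) fun i => freeOne K (a i))
    (by rintro ((_ | _) | i); exacts [hG, hH, isTame_freeOne _])
  obtain ⟨w, h, hwh⟩ := exists_lift_generators ψ hα (hα' (.inl true)) (hα' (.inl false))
    (fun i => hα' (.inr i)) hx
  let Q : PersFun K := ⨁ fun i => freeOne K (w i)
  let g : ∀ i, Q.obj (w i) := fun i =>
    ((biproduct.ι (fun i => freeOne K (w i)) i).app (w i)).hom (freeGen K (w i))
  have hQ : Generates Q w g := generates_biproduct _ w (fun i => freeGen K (w i))
    fun i => generates_freeGen (w i)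
  let η : Q ⟶ H := biproduct.desc fun i => freeDesc (h i)
  have hηg : ∀ i, (η.app (w i)).hom (g i) = h i := by
    intro i
    have : biproduct.ι _ i ≫ η = freeDesc (h i) := biproduct.ι_desc _ _
    rw [← freeDesc_gen (h i), ← this, comp_app_hom]
  have hη : ∀ v c, (η.app v).hom (genMap Q w g v c) = genMap H w h v c := by
    intro v c
    rw [app_genMap]
    simp only [hηg]
  -- The image of `η` has the same image under `ψ` as all of `H`, so together with `kernel ψ` it
  -- spans `H`.
  have : Epi (kernel.ι ψ ≫ cokernel.π η) := by
    rw [epi_iff_app_surjective]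
    intro v z
    obtain ⟨y, rfl⟩ := (epi_iff_app_surjective (cokernel.π η)).1 inferInstance v z
    obtain ⟨c, hc⟩ := hwh v y
    obtain ⟨k, hk⟩ := kernel_app_eq_zero ψ v (y - genMap H w h v c)
      (by rw [map_sub, hc, sub_self])
    refine ⟨k, ?_⟩
    rw [comp_app_hom, hk, map_sub, ← hη, ← comp_app_hom, cokernel.condition, zero_app_hom,
      sub_zero]
  have hS := N.cokernel_comp η φ (kernel.ι ψ) (IsTame.biproduct fun i => isTame_freeOne _) hH hF
    hψ hφ
  obtain ⟨A, hA, hdet⟩ := exists_finset_detecting D.proj (fun v z => D.eq_zero_of_proj) n w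
    fun i => (φ.app (w i)).hom (h i)
  refine le_trans ?_ hA
  rw [← Set.ncard_coe_finset A]
  refine Set.ncard_le_ncard (fun s hs => ?_) A.finite_toSet
  by_contra hsA
  refine hs (μ₁ + τ₂) (lt_of_le_of_lt ?_ hε) ?_
  · calc μ₁ + τ₂ ≤ (μ₁ + μ₂) + (τ₁ + τ₂) := add_le_add le_self_add le_add_self
      _ ≤ μ + τ := add_le_add hμ hτ
      _ ≤ ε := by rwa [add_comm]
  -- An element of the summand `s` lying in the image of `η ≫ φ` has zero projection to every
  -- summand in `A`, so it vanishes by detection.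
  · have : Mono (D.incl s ≫ cokernel.π (η ≫ φ)) := by
      rw [mono_iff_app_injective]
      intro v
      refine (injective_iff_map_eq_zero _).2 fun y hy => ?_
      obtain ⟨q, hq⟩ := cokernel_app_eq_zero (η ≫ φ) v (((D.incl s).app v).hom y) hy
      obtain ⟨c, -, rfl⟩ := hQ.exists_genMap v q
      rw [comp_app_hom, hη, app_genMap] at hq
      have h0 := hdet v c fun i hi => by
        rw [hq, ← comp_app_hom, D.incl_proj_ne, zero_app_hom]
        rintro rfl
        exact hsA hi
      rw [← id_app_hom _ v y, ← D.incl_proj_self, comp_app_hom, ← hq, h0, map_zero]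
    exact N.of_mono (D.incl s ≫ cokernel.π (η ≫ φ)) (D.isTame_summand s) hS

end BarDecomposition

/-! ### The upper bound, and the value of the invariant. -/

namespace NoiseSystem

variable {N : NoiseSystem K}

/-- Embed `X` into an iterated direct sum of the `B i`. Closure under direct sums keeps the size at
`ε`; the extension axiom alone would add the sizes up. -/
theorem of_jointly_mono (hN : N.ClosedUnderDirectSums) {ε : ℚ≥0} {ι : Type*} (T : Finset ι)
    {X : PersFun K} {B : ι → PersFun K} (π : ∀ i, X ⟶ B i) (hB : ∀ i ∈ T, N.S ε (B i))
    (hX : IsTame X)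
    (h : ∀ v (z : X.obj v), (∀ i ∈ T, ((π i).app v).hom z = 0) → z = 0) : N.S ε X := by
  classical
  suffices ∃ (Y : PersFun K) (g : X ⟶ Y), N.S ε Y ∧
      ∀ v (z : X.obj v), (g.app v).hom z = 0 → ∀ i ∈ T, ((π i).app v).hom z = 0 by
    obtain ⟨Y, g, hY, hg⟩ := this
    have : Mono g := by
      rw [mono_iff_app_injective]
      exact fun v => (injective_iff_map_eq_zero _).2 fun z hz => h v z (hg v z hz)
    exact N.of_mono g hX hY
  clear h
  induction T using Finset.induction_on with
  | empty => exact ⟨_, 0, N.zero_mem _ _ (isZero_zero _), by simp⟩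
  | insert i T _ ih =>
    obtain ⟨Y, g, hY, hg⟩ := ih fun j hj => hB j (Finset.mem_insert_of_mem hj)
    refine ⟨Y ⊞ B i, biprod.lift g (π i), hN ε _ _ hY (hB i (Finset.mem_insert_self _ _)),
      fun v z hz j hj => ?_⟩
    rcases Finset.mem_insert.1 hj with rfl | hj
    · rw [← biprod.lift_snd g (π j), comp_app_hom, hz, map_zero]
    · refine hg v z ?_ j hj
      rw [← biprod.lift_fst g (π i), comp_app_hom, hz, map_zero]

end NoiseSystem

namespace BarDecomposition

variable {F : PersFun K} (D : BarDecomposition F) {N : NoiseSystem K}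

/-- The witness is the direct sum of the features of `F`. -/
theorem exists_close_hasRank (hN : N.ClosedUnderDirectSums) (hF : IsTame F) {t : ℚ≥0}
    (ht : 0 < t) : ∃ G : PersFun K, IsTame G ∧ (∃ ε < t, N.IsClose F G ε) ∧
      HasRank G (D.features N t).ncard := by
  classical
  let T : Finset _ := Finset.univ.filter fun s => s ∉ D.features N t
  obtain ⟨ε, hεt, hε⟩ : ∃ ε < t, ∀ s ∈ T, N.S ε (D.summand s) := by
    have hT : ∀ s : T, ∃ ε < t, N.S ε (D.summand s) := by
      rintro ⟨s, hs⟩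
      have h1 := (Finset.mem_filter.1 hs).2
      simpa [features] using h1
    -- A maximum of finitely many sizes below `t` is below `t`; positivity of `t` covers the case of
    -- no sizes, where the supremum is `0`.
    choose δ hδ hS using hT
    refine ⟨Finset.univ.sup δ, (Finset.sup_lt_iff ht).2 fun s _ => hδ s, fun s hs => ?_⟩
    exact N.mono' (Finset.le_sup (Finset.mem_univ (⟨s, hs⟩ : T))) (hS ⟨s, hs⟩)
  have hcard : Nat.card (D.features N t) = (D.features N t).ncard := rfl
  let e : Fin (D.features N t).ncard ≃ D.features N t :=
    (Finite.equivFinOfCardEq hcard).symm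
  let B : Fin (D.features N t).ncard → PersFun K := fun k => D.summand (e k)
  have hG : IsTame (⨁ B) := IsTame.biproduct fun k => D.isTame_summand _
  let p : F ⟶ ⨁ B := biproduct.lift fun k => D.proj (e k)
  have hp : ∀ k, p ≫ biproduct.π B k = D.proj (e k) := fun k => biproduct.lift_π _ _
  let i : ⨁ B ⟶ F := biproduct.desc fun k => D.incl (e k)
  have hip : i ≫ p = 𝟙 _ := by
    refine biproduct.hom_ext' _ _ fun k => biproduct.hom_ext _ _ fun l => ?_
    rw [Category.assoc, Category.assoc, hp, Category.comp_id, biproduct.ι_desc_assoc]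
    by_cases hkl : k = l
    · subst hkl
      rw [biproduct.ι_π_self, incl_proj_self]
    · rw [biproduct.ι_π_ne _ hkl, incl_proj_ne]
      exact fun h => hkl (e.injective (Subtype.ext h))
  have : Epi p := epi_of_epi_fac hip
  -- The roof is `F` itself: the identity costs `0` and the projection `p` costs `ε`.
  refine ⟨⨁ B, hG, ⟨ε, hεt, F, 𝟙 F, p, 0, ε, hF, ⟨0, 0, by simp, ?_, ?_⟩,
    ⟨ε, 0, by simp, ?_, ?_⟩, by simp⟩, ?_⟩
  · exact N.zero_mem _ _ (isZero_kernel_of_mono _)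
  · exact N.zero_mem _ _ (isZero_cokernel_of_epi _)
  · refine N.of_jointly_mono hN T (fun s => kernel.ι p ≫ D.proj s) hε (hF.kernel hG p)
      fun v z hz => ?_
    refine (injective_iff_map_eq_zero _).1 ((mono_iff_app_injective (kernel.ι p)).1 inferInstance v)
      z (D.eq_zero_of_proj fun s => ?_)
    by_cases hs : s ∈ D.features N t
    · obtain ⟨k, hk⟩ := e.surjective ⟨s, hs⟩
      obtain rfl : (e k : _) = s := congrArg Subtype.val hk
      rw [← hp, comp_app_hom, ← comp_app_hom (kernel.ι p), kernel.condition, zero_app_hom,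
        map_zero]
    · exact hz s (Finset.mem_filter.2 ⟨Finset.mem_univ _, hs⟩)
  · exact N.zero_mem _ _ (isZero_cokernel_of_epi _)
  -- A feature is nonzero, since zero functors belong to the component of size `0 < t`.
  · exact hasRank_biproduct (fun k => D.cover (e k)) fun k hk =>
      (e k).2 0 ht (N.zero_mem _ _ hk)

/-- The feature counting invariant counts the summands that are not noise of size less than
`t`. -/
theorem barInv_eq (hN : N.ClosedUnderDirectSums) (hF : IsTame F) {t : ℚ≥0} (ht : 0 < t) :
    N.barInv F t = (((D.barIndices N t).ncard + (D.freeIndices N t).ncard : ℕ) : ℕ∞) := by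
  rw [NoiseSystem.barInv, if_neg ht.ne', ← ncard_features]
  refine le_antisymm ?_ (le_iInf₂ fun G hG => le_iInf₂ fun n hn => ?_)
  · obtain ⟨G, hG, ⟨ε, hεt, hε⟩, hr⟩ := D.exists_close_hasRank hN hF ht
    refine (iInf₂_le G ⟨hG, ?_⟩).trans (iInf₂_le _ hr)
    refine (iInf₂_le ε hε).trans_lt ?_
    exact_mod_cast hεt
  · obtain ⟨hG, hd⟩ := hG
    simp only [NoiseSystem.pseudoDist, iInf_lt_iff] at hd
    obtain ⟨ε, hε, hεt⟩ := hd
    have hεt : ε < t := by exact_mod_cast hεt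
    exact_mod_cast D.ncard_features_le hF hG hεt hε hn

end BarDecomposition

/-! ### Compact tame functors are finitely generated. -/

section Compact

variable {K : Type u} [Field K]

/-- The subfunctor of `F` with given values. -/
noncomputable def subfunctor (F : PersFun K) (A : ∀ v, Submodule K (F.obj v))
    (hA : ∀ a b, a ≤ b → ∀ x ∈ A a, push F a b x ∈ A b) : PersFun K where
  obj v := ModuleCat.of K (A v)
  map {a b} f := ModuleCat.ofHom ((F.map f).hom.restrict fun x hx => by
    rw [map_eq_push]; exact hA a b (leOfHom f) x hx)
  map_id a := by
    ext x
    change (F.map (𝟙 a)).hom x.1 = x.1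
    rw [F.map_id]
    rfl
  map_comp f g := by
    ext x
    change (F.map (f ≫ g)).hom x.1 = (F.map g).hom ((F.map f).hom x.1)
    rw [F.map_comp]
    rfl

/-- The inclusion of a subfunctor. -/
noncomputable def subfunctorι (F : PersFun K) (A : ∀ v, Submodule K (F.obj v))
    (hA : ∀ a b, a ≤ b → ∀ x ∈ A a, push F a b x ∈ A b) : subfunctor F A hA ⟶ F where
  app v := ModuleCat.ofHom (A v).subtype

/-- The working form of compactness. An exhausting increasing sequence of subfunctors is a colimit
because colimits are degreewise and filtered ones can be checked on underlying sets. -/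
theorem IsCompactObj.exists_eq_top {F : PersFun K} (hF : IsCompactObj F)
    (A : ℕ → ∀ v, Submodule K (F.obj v)) (hA : ∀ k a b, a ≤ b → ∀ x ∈ A k a, push F a b x ∈ A k b)
    (hmono : ∀ v, Monotone fun k => A k v) (hunion : ∀ v (x : F.obj v), ∃ k, x ∈ A k v) :
    ∃ k, ∀ v, A k v = ⊤ := by
  let X : ℕ ⥤ PersFun K :=
    { obj := fun k => subfunctor F (A k) (hA k)
      map := fun {k l} f =>
        { app := fun v => ModuleCat.ofHom (Submodule.inclusion (hmono v (leOfHom f))) } }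
  let ι : X ⟶ (Functor.const ℕ).obj F := { app := fun k => subfunctorι F (A k) (hA k) }
  have := reflectsFilteredColimitsOfSize_shrink.{0, u, 0, u} (forget (ModuleCat.{u} K))
  have : ReflectsColimitsOfShape ℕ (forget (ModuleCat.{u} K)) :=
    ReflectsFilteredColimitsOfSize.reflects_filtered_colimits ℕ
  obtain ⟨k, hk⟩ := hF X ι (fun k => (mono_iff_app_injective _).2 fun v => Subtype.val_injective)
    ⟨evaluationJointlyReflectsColimits _ fun v => isColimitOfReflects (forget (ModuleCat.{u} K))
      (Types.FilteredColimit.isColimitOf' _ _ (fun x => (hunion v x).imp fun k hk => ⟨⟨x, hk⟩, rfl⟩)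
        fun i x y h => ⟨i, 𝟙 i, by rw [Subtype.ext h]⟩)⟩
  refine ⟨k, fun v => Submodule.eq_top_iff'.2 fun x => ?_⟩
  obtain ⟨y, rfl⟩ := ((isIso_iff_app_bijective _).1 hk v).2 x
  exact y.2

theorem exists_chain_of_not_finite {V : Type*} [AddCommGroup V] [Module K V] (W : Submodule K V)
    (h : ¬ Module.Finite K (V ⧸ W)) : ∃ C : ℕ → Submodule K V, Monotone C ∧
      (∀ j, W ≤ C j ∧ C j ≠ ⊤) ∧ ∀ x, ∃ j, x ∈ C j := by
  let B := Module.Basis.ofVectorSpace K (V ⧸ W)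
  have hinf : Infinite (Module.Basis.ofVectorSpaceIndex K (V ⧸ W)) := by
    by_contra hfin
    rw [not_infinite_iff_finite] at hfin
    exact h (Module.Finite.of_basis B)
  let f := Infinite.natEmbedding (Module.Basis.ofVectorSpaceIndex K (V ⧸ W))
  -- Fix countably many basis vectors of the quotient; `C j` asks the coordinates from index `j` on
  -- to vanish. It misses the `j`-th vector, while finite supports make the union everything.
  let C : ℕ → Submodule K V := fun j =>
    ⨅ (i : ℕ) (_ : j ≤ i), LinearMap.ker (B.coord (f i) ∘ₗ W.mkQ)
  have hC : ∀ j x, x ∈ C j ↔ ∀ i, j ≤ i → B.repr (W.mkQ x) (f i) = 0 := fun j x => by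
    simp only [C, Submodule.mem_iInf, LinearMap.mem_ker, LinearMap.comp_apply,
      Module.Basis.coord_apply]
  refine ⟨C, fun j k hjk x hx => ?_, fun j => ⟨fun x hx => ?_, fun htop => ?_⟩, fun x => ?_⟩
  · rw [hC] at hx ⊢
    exact fun i hi => hx i (hjk.trans hi)
  · rw [hC]
    intro i _
    have : W.mkQ x = 0 := (Submodule.Quotient.mk_eq_zero W).2 hx
    rw [this, map_zero, Finsupp.zero_apply]
  · obtain ⟨y, hy⟩ := W.mkQ_surjective (B (f j))
    have h1 : y ∈ C j := htop ▸ Submodule.mem_top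
    have h2 := (hC j y).1 h1 j le_rfl
    rw [hy, B.repr_self, Finsupp.single_eq_same] at h2
    exact one_ne_zero h2
  · have hfin : {i | B.repr (W.mkQ x) (f i) ≠ 0}.Finite := by
      refine Set.Finite.preimage f.injective.injOn (s := {s | B.repr (W.mkQ x) s ≠ 0}) ?_
      exact (Finsupp.hasFiniteSupport _)
    obtain ⟨j, hj⟩ := hfin.bddAbove
    refine ⟨j + 1, (hC _ _).2 fun i hi => ?_⟩
    by_contra hne
    exact absurd (hj hne) (by omega)

/-- The subfunctors generated in degrees up to `α * k` exhaust `F`, so one of them is `F`. -/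
theorem IsCompactObj.exists_push_surjective {F : PersFun K} (hF : IsCompactObj F) {α : ℚ≥0}
    (hα : 0 < α) : ∃ k : ℕ, ∀ v, Function.Surjective (push F (min v (α * k)) v) := by
  suffices ∃ k : ℕ, ∀ v, LinearMap.range (push F (min v (α * k)) v) = ⊤ from
    this.imp fun k hk v => LinearMap.range_eq_top.1 (hk v)
  refine hF.exists_eq_top (fun k v => LinearMap.range (push F (min v (α * k)) v)) ?_ ?_ ?_
  · rintro k a b hab _ ⟨z, rfl⟩
    have h1 : min a (α * (k : ℚ≥0)) ≤ min b (α * k) := min_le_min_right _ hab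
    refine ⟨push F _ _ z, ?_⟩
    rw [push_push F h1 (min_le_left _ _), push_push F (min_le_left _ _) hab]
  · rintro v k l hkl _ ⟨z, rfl⟩
    have h1 : min v (α * (k : ℚ≥0)) ≤ min v (α * l) := by gcongr
    exact ⟨push F _ _ z, push_push F h1 (min_le_left _ _) _⟩
  · intro v x
    obtain ⟨k, hk⟩ := exists_nat_ge (v / α)
    have h1 : v ≤ α * k := by rwa [div_le_iff₀' hα] at hk
    exact ⟨k, push F _ _ x, by rw [push_push F (le_min le_rfl h1) (min_le_left _ _), push_self]⟩

theorem IsCompactObj.finite_quotient {F : PersFun K} (hF : IsCompactObj F) {α : ℚ≥0}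
    (hα : 0 < α) (hFα : TameOn α F) (m : ℕ) (W : Submodule K (F.obj (α * m)))
    (hW : ∀ a < α * m, LinearMap.range (push F a (α * m)) ≤ W) :
    Module.Finite K (F.obj (α * m) ⧸ W) := by
  classical
  by_contra hn
  obtain ⟨C, hC, hCW, hCu⟩ := exists_chain_of_not_finite W hn
  suffices ∃ k : ℕ, ∀ v, (if gridFloor α v = m then (C k).map (push F (α * m) v) else ⊤) = ⊤ by
    obtain ⟨k, hk⟩ := this
    refine (hCW k).2 (eq_top_iff.2 fun x _ => ?_)
    have h1 := hk (α * m)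
    rw [if_pos (gridFloor_mul hα m)] at h1
    obtain ⟨y, hy, rfl⟩ := h1.ge (Submodule.mem_top (x := x))
    rwa [push_self]
  -- Replace `F` by `C k` on the single grid cell `m` and leave it unchanged elsewhere. This is a
  -- subfunctor because everything arriving from before the cell lands in `W ≤ C k`.
  refine hF.exists_eq_top
    (fun k v => if gridFloor α v = m then (C k).map (push F (α * m) v) else ⊤) ?_ ?_ ?_
  · intro k a b hab x hx
    by_cases hb : gridFloor α b = m
    · have hmb : α * m ≤ b := hb ▸ mul_gridFloor_le hα b
      rw [if_pos hb]
      by_cases ha : gridFloor α a = m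
      · rw [if_pos ha] at hx
        obtain ⟨y, hy, rfl⟩ := hx
        exact ⟨y, hy, (push_push F (ha ▸ mul_gridFloor_le hα a) hab y).symm⟩
      · have ham : a < α * m := by
          rw [← not_le, mul_le_iff_le_gridFloor hα]
          have := gridFloor_mono α hab
          omega
        exact ⟨push F a (α * m) x, (hCW k).1 (hW a ham ⟨x, rfl⟩), push_push F ham.le hmb x⟩
    · rw [if_neg hb]
      trivial
  · intro v k l hkl
    dsimp only
    split_ifs
    · exact Submodule.map_mono (hC hkl)
    · exact le_rfl
  · intro v x
    by_cases hv : gridFloor α v = m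
    · subst hv
      obtain ⟨y, rfl⟩ := (hFα.push_bijective hα v).2 x
      obtain ⟨k, hk⟩ := hCu y
      exact ⟨k, by rw [if_pos rfl]; exact ⟨y, hk, rfl⟩⟩
    · exact ⟨0, by rw [if_neg hv]; trivial⟩

theorem push_mem_span {F : PersFun K} {ι : Type*} (a : ι → ℚ≥0) (x : ∀ i, F.obj (a i)) {v w : ℚ≥0}
    (h : v ≤ w) {z : F.obj v} (hz : z ∈ Submodule.span K (Set.range fun i => push F (a i) v (x i))) :
    push F v w z ∈ Submodule.span K (Set.range fun i => push F (a i) w (x i)) := by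
  have h1 := Submodule.mem_map_of_mem (f := push F v w) hz
  rw [Submodule.map_span] at h1
  refine Submodule.span_le.2 ?_ h1
  rintro _ ⟨_, ⟨i, rfl⟩, rfl⟩
  by_cases hi : a i ≤ v
  · dsimp only
    rw [push_push F hi h]
    exact Submodule.subset_span ⟨i, rfl⟩
  · dsimp only
    rw [push_of_not_le F hi, LinearMap.zero_apply, map_zero]
    exact zero_mem _

/-- A compact tame functor has finitely many generators, in degrees on the grid. -/
theorem IsCompactObj.exists_generates {F : PersFun K} (hF : IsCompactObj F) {α : ℚ≥0}
    (hα : 0 < α) (hFα : TameOn α F) :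
    ∃ (n : ℕ) (a : Fin n → ℚ≥0) (x : ∀ i, F.obj (a i)), Generates F a x ∧
      ∀ i, TameOn α (freeOne K (a i)) := by
  classical
  obtain ⟨k, hk⟩ := hF.exists_push_surjective hα
  -- `W m` is what arrives from lower degrees; lifts of a finite spanning set of the quotient are
  -- the new generators needed in degree `α * m`.
  let W : ∀ m : ℕ, Submodule K (F.obj (α * m)) := fun m =>
    ⨆ (a : ℚ≥0) (_ : a < α * m), LinearMap.range (push F a (α * m))
  have hW : ∀ m : ℕ, ∃ s : Finset (F.obj (α * m)),
      Submodule.span K (s : Set (F.obj (α * m))) ⊔ W m = ⊤ := by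
    intro m
    have hfin := hF.finite_quotient hα hFα m (W m) fun a ha => le_iSup₂_of_le a ha le_rfl
    obtain ⟨s, hs⟩ := hfin.fg_top
    obtain ⟨t, ht⟩ : ∃ t : Finset (F.obj (α * m)), t.image (W m).mkQ = s := by
      obtain ⟨t, -, ht⟩ := Finset.subset_set_image_iff.1
        (show (s : Set (F.obj (α * m) ⧸ W m)) ⊆ (W m).mkQ '' Set.univ by
          rw [Set.image_univ, LinearMap.range_eq_top.1 (W m).range_mkQ |>.range_eq]
          exact Set.subset_univ _)
      exact ⟨t, ht⟩
    refine ⟨t, ?_⟩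
    rw [← ht, Finset.coe_image, ← Submodule.map_span] at hs
    have h1 := congrArg (Submodule.comap (W m).mkQ) hs
    rwa [Submodule.comap_map_mkQ, Submodule.comap_top, sup_comm] at h1
  choose s hs using hW
  let ι := Σ m : Fin (k + 1), s m
  let a : ι → ℚ≥0 := fun i => α * (i.1 : ℕ)
  let x : ∀ i : ι, F.obj (a i) := fun i => i.2.1
  let M : ∀ v, Submodule K (F.obj v) := fun v =>
    Submodule.span K (Set.range fun i => push F (a i) v (x i))
  have hgrid : ∀ m : ℕ, m ≤ k → M (α * m) = ⊤ := by
    intro m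
    induction m using Nat.strong_induction_on with
    | _ m ih =>
    intro hm
    rw [eq_top_iff, ← hs m, sup_le_iff, Submodule.span_le]
    constructor
    · intro y hy
      refine Submodule.subset_span ⟨⟨⟨m, Nat.lt_succ_of_le hm⟩, ⟨y, hy⟩⟩, ?_⟩
      exact push_self F _ y
    · refine iSup₂_le fun b hb => ?_
      rintro _ ⟨z, rfl⟩
      obtain ⟨y, rfl⟩ := (hFα.push_bijective hα b).2 z
      have h1 : gridFloor α b < m := by rwa [← not_le, ← mul_le_iff_le_gridFloor hα, not_le]
      rw [push_push F (mul_gridFloor_le hα b) hb.le]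
      refine push_mem_span a x ((mul_gridFloor_le hα b).trans hb.le) ?_
      exact (ih _ h1 (h1.le.trans hm)).ge trivial
  have hgen : Generates F a x := by
    intro v
    rw [eq_top_iff]
    intro z _
    obtain ⟨y, rfl⟩ := hk v z
    obtain ⟨y', rfl⟩ := (hFα.push_bijective hα _).2 y
    refine push_mem_span a x (min_le_left _ _) (push_mem_span a x (mul_gridFloor_le hα _) ?_)
    refine (hgrid _ ?_).ge trivial
    exact (gridFloor_mono α (min_le_right _ _)).trans_eq (gridFloor_mul hα k)
  let e := Fintype.equivFin ι
  refine ⟨_, fun i => a (e.symm i), fun i => x (e.symm i), fun v => ?_,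
    fun i => tameOn_freeOne hα _⟩
  rw [← hgen v]
  congr 1
  exact e.symm.surjective.range_comp fun i => push F (a i) v (x i)

end Compact

/-! ### Decomposition into bars and free functors. -/

section Structure

variable {K : Type u} [Field K]

theorem generates_biprod {ι κ : Type*} {F G : PersFun K} {c : ι ⊕ κ → ℚ≥0}
    {x : ∀ i, F.obj (c (.inl i))} {y : ∀ j, G.obj (c (.inr j))}
    (hx : Generates F (fun i => c (.inl i)) x) (hy : Generates G (fun j => c (.inr j)) y) :
    Generates (F ⊞ G) c fun s => Sum.rec
      (motive := fun s => (F ⊞ G).obj (c s))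
      (fun i => ((biprod.inl : F ⟶ F ⊞ G).app _).hom (x i))
      (fun j => ((biprod.inr : G ⟶ F ⊞ G).app _).hom (y j)) s := by
  intro v
  rw [eq_top_iff]
  intro z _
  have h := congrArg (fun f : F ⊞ G ⟶ F ⊞ G => (NatTrans.app f v).hom z)
    (biprod.total (X := F) (Y := G))
  have h' : z = ((biprod.inl : F ⟶ F ⊞ G).app v).hom (((biprod.fst : F ⊞ G ⟶ F).app v).hom z)
      + ((biprod.inr : G ⟶ F ⊞ G).app v).hom (((biprod.snd : F ⊞ G ⟶ G).app v).hom z) := h.symm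
  rw [h']
  refine add_mem ?_ ?_
  · have h1 := Submodule.mem_map_of_mem (f := ((biprod.inl : F ⟶ F ⊞ G).app v).hom)
      ((hx v).ge (Submodule.mem_top (x := ((biprod.fst : F ⊞ G ⟶ F).app v).hom z)))
    rw [Submodule.map_span] at h1
    refine Submodule.span_le.2 ?_ h1
    rintro _ ⟨_, ⟨i, rfl⟩, rfl⟩
    exact Submodule.subset_span ⟨.inl i, (app_push _ _ _ _).symm⟩
  · have h1 := Submodule.mem_map_of_mem (f := ((biprod.inr : G ⟶ F ⊞ G).app v).hom)
      ((hy v).ge (Submodule.mem_top (x := ((biprod.snd : F ⊞ G ⟶ G).app v).hom z)))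
    rw [Submodule.map_span] at h1
    refine Submodule.span_le.2 ?_ h1
    rintro _ ⟨_, ⟨i, rfl⟩, rfl⟩
    exact Submodule.subset_span ⟨.inr i, (app_push _ _ _ _).symm⟩

/-- A tame functor with finitely many generators is a direct sum of bars and free functors. -/
theorem nonempty_barDecomposition {F : PersFun K} {α : ℚ≥0} (hα : 0 < α) (hF : TameOn α F) {n : ℕ}
    {a : Fin n → ℚ≥0} {x : ∀ i, F.obj (a i)} (hx : Generates F a x)
    (ha : ∀ i, TameOn α (freeOne K (a i))) : Nonempty (BarDecomposition F) := by
  classical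
  -- `P v` holds the live coefficient vectors and `R v` the relations among them. The basis must be
  -- adapted to both so that each vector has its own birth and death.
  let P : ℚ≥0 → Submodule K (Fin n → K) := liveCoeffs K a
  let R : ℚ≥0 → Submodule K (Fin n → K) := fun v => P v ⊓ LinearMap.ker (genMap F a x v)
  have hP : Monotone P := liveCoeffs_mono a
  have hR : Monotone R := by
    rintro v w h c ⟨hc, h0⟩
    refine ⟨hP h hc, ?_⟩
    have h0 : genMap F a x v c = 0 := h0
    rw [SetLike.mem_coe, LinearMap.mem_ker, ← push_genMap F a x h hc, h0, map_zero]
  have hPgrid : ∀ v, ∀ c ∈ P v, c ∈ P (α * gridFloor α v) := fun v c hc i hi =>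
    hc i fun h => hi (le_grid_of_tameOn_freeOne hα (ha i) h)
  have hRgrid : ∀ v, ∀ c ∈ R v, c ∈ R (α * gridFloor α v) := by
    rintro v c ⟨hc, h0⟩
    refine ⟨hPgrid v c hc, (hF.push_bijective hα v).1 ?_⟩
    have h0 : genMap F a x v c = 0 := h0
    rw [push_genMap F a x (mul_gridFloor_le hα v) (hPgrid v c hc), h0, map_zero]
  obtain ⟨b₀, hb₀⟩ := exists_adapted_basis (C := Set.range P) (D := Set.range R)
    hP.isChain_range hR.isChain_range (Module.finrank_fin_fun K)
  -- split the basis into the vectors that die and those that do not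
  let dead : Fin n → Prop := fun i => {v | b₀ i ∈ R v}.Nonempty
  let e : Fin (Fintype.card {i // dead i}) ⊕ Fin (Fintype.card {i // ¬ dead i}) ≃ Fin n :=
    (Equiv.sumCongr (Fintype.equivFin _).symm (Fintype.equivFin _).symm).trans
      (Equiv.sumCompl dead)
  have hel : ∀ i, dead (e (.inl i)) := fun i => ((Fintype.equivFin {i // dead i}).symm i).2
  have her : ∀ j, ¬ dead (e (.inr j)) := fun j => ((Fintype.equivFin {i // ¬ dead i}).symm j).2
  obtain ⟨b, hbdef⟩ : ∃ b : Module.Basis _ K (Fin n → K), b = b₀.reindex e.symm := ⟨_, rfl⟩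
  have hb_apply : ∀ s, b s = b₀ (e s) := fun s => by
    rw [hbdef, Module.Basis.reindex_apply, Equiv.symm_symm]
  have hb : ∀ U ∈ Set.range P ∪ Set.range R, ∀ z ∈ U, ∀ s, b.repr z s ≠ 0 → b s ∈ U := by
    intro U hU z hz s hs
    rw [hb_apply]
    refine hb₀ U hU z hz _ ?_
    rwa [hbdef, Module.Basis.repr_reindex_apply, Equiv.symm_symm] at hs
  have hborn : ∀ s, ∃ w, IsLeast {v | b s ∈ P v} w := fun s =>
    -- From the largest generator degree on, every coefficient vector is live.
    exists_isLeast_of_grid hα ⟨Finset.univ.sup a, fun i hi =>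
      absurd (Finset.le_sup (Finset.mem_univ i)) hi⟩ fun v hv => hPgrid v _ hv
  choose w hw using hborn
  have hdies : ∀ i, ∃ u, IsLeast {v | b (.inl i) ∈ R v} u := fun i =>
    exists_isLeast_of_grid hα (by
      obtain ⟨v, hv⟩ := hel i
      exact ⟨v, (hb_apply (.inl i)).symm ▸ hv⟩) fun v hv => hRgrid v _ hv
  choose u hu using hdies
  have hwu : ∀ i, w (.inl i) ≤ u i := fun i => (hw _).2 (hu i).1.1
  let f : ∀ s, F.obj (w s) := fun s => genMap F a x (w s) (b s)
  have hf : ∀ s v, w s ≤ v → push F (w s) v (f s) = genMap F a x v (b s) := fun s v h =>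
    push_genMap F a x h (hw s).1
  have hfu : ∀ i, push F (w (.inl i)) (u i) (f (.inl i)) = 0 := fun i =>
    (hf _ _ (hwu i)).trans (hu i).1.2
  have hfgen : Generates F w f := by
    intro v
    rw [eq_top_iff]
    intro z _
    obtain ⟨c, hc, rfl⟩ := hx.exists_genMap v z
    rw [← b.sum_repr c, map_sum]
    refine sum_mem fun s _ => ?_
    rw [map_smul]
    by_cases hs : b.repr c s = 0
    · rw [hs, zero_smul]
      exact zero_mem _
    · have h1 : w s ≤ v := (hw s).2 (hb (P v) (.inl ⟨v, rfl⟩) c hc s hs)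
      rw [← hf s v h1]
      exact Submodule.smul_mem _ _ (Submodule.subset_span ⟨s, rfl⟩)
  let X : PersFun K := ⨁ fun i => bar K (hwu i)
  let Y : PersFun K := ⨁ fun j => freeOne K (w (.inr j))
  let Φ₁ : X ⟶ F := biproduct.desc fun i => barDesc (hwu i) (f (.inl i)) (hfu i)
  let Φ₂ : Y ⟶ F := biproduct.desc fun j => freeDesc (f (.inr j))
  let Φ : X ⊞ Y ⟶ F := biprod.desc Φ₁ Φ₂
  let gX : ∀ i, X.obj (w (.inl i)) := fun i =>
    ((biproduct.ι (fun i => bar K (hwu i)) i).app _).hom (barGen K (hwu i))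
  let gY : ∀ j, Y.obj (w (.inr j)) := fun j =>
    ((biproduct.ι (fun j => freeOne K (w (.inr j))) j).app _).hom (freeGen K (w (.inr j)))
  have hX : Generates X (fun i => w (.inl i)) gX :=
    generates_biproduct _ (fun i => w (.inl i)) (fun i => barGen K (hwu i))
      fun i => generates_barGen (hwu i)
  have hY : Generates Y (fun j => w (.inr j)) gY :=
    generates_biproduct _ (fun j => w (.inr j)) (fun j => freeGen K (w (.inr j)))
      fun j => generates_freeGen (w (.inr j))
  obtain ⟨g, hg, hgl, hgr⟩ : ∃ g : ∀ s, (X ⊞ Y).obj (w s), Generates (X ⊞ Y) w g ∧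
      (∀ i, g (.inl i) = ((biprod.inl : X ⟶ X ⊞ Y).app _).hom (gX i)) ∧
      ∀ j, g (.inr j) = ((biprod.inr : Y ⟶ X ⊞ Y).app _).hom (gY j) :=
    ⟨_, generates_biprod hX hY, fun _ => rfl, fun _ => rfl⟩
  have hΦ : ∀ s, (Φ.app (w s)).hom (g s) = f s := by
    rintro (i | j)
    · have h1 : biprod.inl ≫ Φ = Φ₁ := biprod.inl_desc _ _
      have h2 : biproduct.ι (fun i => bar K (hwu i)) i ≫ Φ₁
          = barDesc (hwu i) (f (.inl i)) (hfu i) := biproduct.ι_desc _ _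
      rw [hgl, ← comp_app_hom, h1, ← comp_app_hom, h2, barDesc_gen]
    · have h1 : biprod.inr ≫ Φ = Φ₂ := biprod.inr_desc _ _
      have h2 : biproduct.ι (fun j => freeOne K (w (.inr j))) j ≫ Φ₂
          = freeDesc (f (.inr j)) := biproduct.ι_desc _ _
      rw [hgr, ← comp_app_hom, h1, ← comp_app_hom, h2, freeDesc_gen]
  have hepi : Epi Φ := epi_of_generates hfgen Φ g hΦ
  have hinj : ∀ v, Function.Injective (Φ.app v).hom := by
    intro v
    refine (injective_iff_map_eq_zero _).2 fun z hz => ?_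
    obtain ⟨c, hc, rfl⟩ := hg.exists_genMap v z
    have hlive : ∀ s, c s ≠ 0 → w s ≤ v := fun s hs => by
      by_contra h
      exact hs (hc s h)
    -- An element killed by `Φ` is a relation `d`. Adaptedness to `R v` makes every basis vector
    -- occurring in `d` a relation by itself, so its bar has already ended by degree `v`; a free
    -- summand cannot occur.
    let d := ∑ s, c s • b s
    have hd : d ∈ R v := by
      constructor
      · refine sum_mem fun s _ => ?_
        by_cases hs : c s = 0
        · rw [hs, zero_smul]
          exact zero_mem _
        · exact Submodule.smul_mem _ _ (hP (hlive s hs) (hw s).1)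
      · rw [app_genMap, genMap_apply] at hz
        rw [SetLike.mem_coe, LinearMap.mem_ker, ← hz, map_sum]
        refine Finset.sum_congr rfl fun s _ => ?_
        rw [map_smul, hΦ]
        by_cases hs : c s = 0
        · rw [hs, zero_smul, zero_smul]
        · rw [hf s v (hlive s hs)]
    have hcd : ∀ s, b.repr d s = c s := fun s => by rw [Module.Basis.repr_sum_self]
    rw [genMap_apply]
    refine Finset.sum_eq_zero fun s _ => ?_
    by_cases hs : c s = 0
    · rw [hs, zero_smul]
    have hsR : b s ∈ R v := hb (R v) (.inr ⟨v, rfl⟩) d hd s (by rwa [hcd])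
    rcases s with i | j
    · rw [hgl, ← app_push]
      have h1 : push X (w (.inl i)) v (gX i) = 0 := by
        rw [← app_push, push_barGen_eq_zero (hwu i) ((hu i).2 hsR), map_zero]
      rw [h1, map_zero, smul_zero]
    · exact absurd ⟨v, (hb_apply (.inr j)) ▸ hsR⟩ (her j)
  have hiso : IsIso Φ := (isIso_iff_app_bijective Φ).2 fun v =>
    ⟨hinj v, (epi_iff_app_surjective Φ).1 hepi v⟩
  exact ⟨⟨_, _, fun i => w (.inl i), u, hwu, fun j => w (.inr j), (asIso Φ).symm⟩⟩

end Structure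

end FeatureCounting

theorem mainTheorem3 {K : Type u} [Field K] (N : FeatureCounting.NoiseSystem K)
    (hN : N.ClosedUnderDirectSums) (F : FeatureCounting.PersFun K)
    (hFtame : FeatureCounting.IsTame F) (hFcompact : FeatureCounting.IsCompactObj F) :
    Nonempty (FeatureCounting.BarDecomposition F) ∧
    ∀ (D : FeatureCounting.BarDecomposition F) (t : ℚ≥0), 0 < t →
      N.barInv F t =
        (((D.barIndices N t).ncard + (D.freeIndices N t).ncard : ℕ) : ℕ∞) := by
  refine ⟨?_, fun D t ht => D.barInv_eq hN hFtame ht⟩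
  obtain ⟨α, hα, hF⟩ := hFtame.exists_tameOn
  obtain ⟨n, a, x, hx, ha⟩ := hFcompact.exists_generates hα hF
  exact FeatureCounting.nonempty_barDecomposition hα hF hx ha
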